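/- Let $K$ be an algebraically closed field of characteristic zero. For a finite-dimensional Lie algebra $\mathfrak g$ over $K$ let $\operatorname{ind}\mathfrak g=\min_{f\in\mathfrak g^*}\dim\ker B_f$, where $B_f(x,y)=f([x,y])$. A composition of a positive integer $n$ is a finite sequence of positive integers with sum $n$. For compositions $a=(a_1,\dots,a_m)$ and $b=(b_1,\dots,b_t)$ of $n$, let $\mathfrak p_n(a,b)$ be the seaweed subalgebra of type $a\,|\,b$, that is, the Lie algebra of all traceless $n\times n$ matrices over $K$ that map each of the subspaces $$V_i=\operatorname{span}\{e_1,\dots,e_{a_1+\cdots+a_i}\}\ (0\le i\le m),\qquad W_j=\operatorname{span}\{e_{b_1+\cdots+b_j+1},\dots,e_n\}\ (0\le j\le t)$$ of $K^n$ to itself, where $e_1,\dots,e_n$ is the standard basis. For $n\ge 1$ and $k\ge 0$ let $C(n,k)$ be the number of ordered pairs $(a,b)$ of compositions of $n$ such that $\operatorname{ind}\mathfrak p_n(a,b)=k$. Then for every integer $n\ge 1$, $$50\,C(n,n-1)+8\,C(n+1,n-1)+2\,C(n+4,n+1)=C(n+5,n+2).$$ -/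

import Mathlib

/-- The Kirillov form `B_f(x, y) = f([x, y])` of a linear form `f` on a Lie algebra. -/
def kirillovForm {K L : Type*} [Field K] [LieRing L] [LieAlgebra K L]
    (f : Module.Dual K L) : L →ₗ[K] L →ₗ[K] K :=
  LinearMap.mk₂ K (fun x y => f ⁅x, y⁆)
    (fun x x' y => by simp) (fun c x y => by simp)
    (fun x y y' => by simp) (fun c x y => by simp)

theorem kirillovForm_apply {K L : Type*} [Field K] [LieRing L] [LieAlgebra K L]
    (f : Module.Dual K L) (x y : L) : kirillovForm f x y = f ⁅x, y⁆ := rfl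

/-- The index of a finite-dimensional Lie algebra `L` over `K`: the minimum over all linear forms
`f` of the dimension of the kernel of the Kirillov form `B_f`. -/
noncomputable def lieIndex (K L : Type*) [Field K] [LieRing L] [LieAlgebra K L] : ℕ :=
  sInf (Set.range fun f : Module.Dual K L => Module.finrank K (LinearMap.ker (kirillovForm f)))

/-- `V_i`, the span of `e_1, …, e_{a_1 + ⋯ + a_i}` in `K^n` (coordinates are numbered from `0`
in the code). -/
def ascFlag (K : Type*) [Field K] {n : ℕ} (a : Composition n) (i : ℕ) :
    Submodule K (Fin n → K) :=
  Submodule.span K {v | ∃ s : Fin n, (s : ℕ) < a.sizeUpTo i ∧ v = Pi.single s 1}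

/-- `W_j`, the span of `e_{b_1 + ⋯ + b_j + 1}, …, e_n` in `K^n`. -/
def descFlag (K : Type*) [Field K] {n : ℕ} (b : Composition n) (j : ℕ) :
    Submodule K (Fin n → K) :=
  Submodule.span K {v | ∃ s : Fin n, b.sizeUpTo j ≤ (s : ℕ) ∧ v = Pi.single s 1}

/-- The Lie subalgebra of `sl(n)` of matrices that map a subspace `U` of `K^n` to itself. -/
def slStabilizer (K : Type*) [Field K] {n : ℕ} (U : Submodule K (Fin n → K)) :
    LieSubalgebra K (LieAlgebra.SpecialLinear.sl (Fin n) K) where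
  carrier := {A | ∀ v ∈ U, (A : Matrix (Fin n) (Fin n) K).mulVec v ∈ U}
  zero_mem' := by
    intro v _
    simp
  add_mem' := by
    intro A B hA hB v hv
    simpa [Matrix.add_mulVec] using U.add_mem (hA v hv) (hB v hv)
  smul_mem' := by
    intro c A hA v hv
    simpa [Matrix.smul_mulVec] using U.smul_mem c (hA v hv)
  lie_mem' := by
    intro A B hA hB v hv
    have h := U.sub_mem (hA _ (hB v hv)) (hB _ (hA v hv))
    simpa [Ring.lie_def, Matrix.sub_mulVec, Matrix.mulVec_mulVec] using h

/-- The seaweed subalgebra of `sl(n)` of type `a | b`: the traceless matrices that preserve every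
member of the flag `V_0 ⊂ ⋯ ⊂ V_m` of `a` and of the flag `W_0 ⊃ ⋯ ⊃ W_t` of `b`. -/
def seaweed (K : Type*) [Field K] {n : ℕ} (a b : Composition n) :
    LieSubalgebra K (LieAlgebra.SpecialLinear.sl (Fin n) K) :=
  (⨅ i : Fin (a.length + 1), slStabilizer K (ascFlag K a i)) ⊓
    (⨅ j : Fin (b.length + 1), slStabilizer K (descFlag K b j))

/-- `C(n, k)`: the number of ordered pairs of compositions of `n` whose seaweed subalgebra of
`sl(n)` has index `k`. -/
noncomputable def seaweedCount (K : Type*) [Field K] (n k : ℕ) : ℕ :=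
  Nat.card {p : Composition n × Composition n // lieIndex K (seaweed K p.1 p.2) = k}

/-! Pass from `sl n` to `gl n`. There the seaweed algebra is the space of matrices supported on a
transitive relation on positions, and every linear form is `tr (F ·)`. As `n` is nonzero in `K`,
scalars split off and the index grows by exactly one (`lieIndex_seaweed_add_one`). So index `n - 1 -
d` in `sl n` means that the defect, `n` minus the index in `gl n`, equals `d`; the identity relates
the numbers of pairs of defect 0, 1 and 2.

The index in `gl n` obeys an inductive procedure on the first parts `k` and `l` of the two
compositions. If `k = l`, a factor `gl k` of index `k` splits off (`listIndex_cons_cons`). If `k <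
l`, the `k × (l - k)` block of positions is an abelian ideal. A generic form pairs its rows and
columns with maximal rank, and the stabilizer of that pairing is, modulo the ideal, a smaller
seaweed algebra of the same index: `k | k+e+k` becomes `∅ | e, k` (`listIndex_short`), and `e+m |
e+2m` becomes `e | e+m` (`listIndex_long`). Both are instances of `IsReduction.relIndex_eq`, which
rests on a lemma on radicals (`finrank_radOn_eq`) and on semicontinuity of kernel dimensions.

In terms of the defect, a common first part costs nothing and the other two moves cost `k` and `m`
(`IsDefect`). Hence defect 0 means `a = b`, and the pairs of defect 1 or 2 can be described by
bounded unwinding of the recursion. Counting them gives `2 ^ (n - 1)` for defect 0, a linear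
recursion for defect 1 (`cnt_one_succ`), and for defect 2 an expression in counts of defect 1 and
powers of two (`cnt_lt_two`). Eliminating the sums yields the identity (`cnt_recursion`). -/

/-! ### Semicontinuity of kernel dimension along a pencil of linear maps. -/

theorem finite_setOf_finrank_range_add_smul_lt {K V W : Type*} [Field K] [AddCommGroup V]
    [Module K V] [FiniteDimensional K V] [AddCommGroup W] [Module K W] [FiniteDimensional K W]
    (A C : V →ₗ[K] W) :
    {t : K | Module.finrank K (LinearMap.range (A + t • C)) <
      Module.finrank K (LinearMap.range A)}.Finite := by
  obtain ⟨V', hV'⟩ := Submodule.exists_isCompl (LinearMap.ker A)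
  have hinj : LinearMap.ker (A ∘ₗ V'.subtype) = ⊥ := by
    rw [LinearMap.ker_eq_bot']
    intro v hv
    have h1 : (v : V) ∈ LinearMap.ker A ⊓ V' := ⟨by simpa using hv, v.2⟩
    rw [hV'.inf_eq_bot] at h1
    exact Subtype.ext (by simpa using h1)
  obtain ⟨G, hG⟩ := LinearMap.exists_leftInverse_of_injective _ hinj
  have hdim : Module.finrank K (LinearMap.range A) = Module.finrank K V' := by
    have h1 := LinearMap.finrank_range_add_finrank_ker A
    have h2 := Submodule.finrank_add_eq_of_isCompl hV'
    omega
  -- On `V'` the composite of `G` with `A + t • C` is `1 + t X`, so the restriction of `A + t • C`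
  -- to `V'` is injective unless `-t⁻¹` is an eigenvalue of `X`.
  set X : Module.End K V' := G ∘ₗ C ∘ₗ V'.subtype with hX
  have hfin : {μ : K | Module.End.HasEigenvalue X μ}.Finite := by
    simpa using Module.End.finite_hasEigenvalue X
  refine ((hfin.preimage (f := fun t : K => -t⁻¹) ?_)).subset ?_
  · intro a _ b _ h
    simpa using h
  · intro t ht
    by_contra hne
    have hker : LinearMap.ker ((A + t • C) ∘ₗ V'.subtype) = ⊥ := by
      rw [LinearMap.ker_eq_bot']
      intro v hv
      by_contra hv0
      have h1 : v + t • X v = 0 := by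
        have h2 := congrArg G hv
        have h3 := LinearMap.congr_fun hG v
        simp only [LinearMap.comp_apply, LinearMap.add_apply, LinearMap.smul_apply, map_add,
          map_smul, LinearMap.id_apply, map_zero] at h2 h3
        rw [h3] at h2
        simpa [hX] using h2
      have ht0 : t ≠ 0 := by
        rintro rfl
        simp at h1
        exact hv0 h1
      apply hne
      refine Module.End.hasEigenvalue_of_hasEigenvector (x := v)
        ⟨Module.End.mem_eigenspace_iff.2 ?_, hv0⟩
      have h4 : X v = t⁻¹ • (t • X v) := by rw [smul_smul, inv_mul_cancel₀ ht0, one_smul]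
      rw [h4, eq_neg_of_add_eq_zero_right h1, smul_neg, neg_smul]
    have h5 := LinearMap.finrank_range_of_inj (LinearMap.ker_eq_bot.1 hker)
    have h6 : LinearMap.range ((A + t • C) ∘ₗ V'.subtype) ≤ LinearMap.range (A + t • C) :=
      LinearMap.range_comp_le_range _ _
    have h7 := Submodule.finrank_mono h6
    simp only [Set.mem_ofPred_eq] at ht
    omega

/-- The rank cannot drop below that of `A` at more than finitely many `t`. A lower bound for kernels
thus needs to be proved for generic perturbations only. -/
theorem le_finrank_ker_of_infinite {K V W : Type*} [Field K] [AddCommGroup V]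
    [Module K V] [FiniteDimensional K V] [AddCommGroup W] [Module K W] [FiniteDimensional K W]
    (A C : V →ₗ[K] W) (d : ℕ)
    (h : {t : K | d ≤ Module.finrank K (LinearMap.ker (A + t • C))}.Infinite) :
    d ≤ Module.finrank K (LinearMap.ker A) := by
  obtain ⟨t, ht, ht'⟩ := (h.sdiff (finite_setOf_finrank_range_add_smul_lt A C)).nonempty
  simp only [Set.mem_ofPred_eq, not_lt] at ht ht'
  have h1 := LinearMap.finrank_range_add_finrank_ker A
  have h2 := LinearMap.finrank_range_add_finrank_ker (A + t • C)
  omega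

/-! ### Radicals of restricted bilinear forms. -/

/-- The radical of the restriction of a bilinear form to a subspace. -/
def radOn {K E : Type*} [Field K] [AddCommGroup E] [Module K E] (B : E →ₗ[K] E →ₗ[K] K)
    (Q : Submodule K E) : Submodule K E where
  carrier := {x | x ∈ Q ∧ ∀ y ∈ Q, B x y = 0}
  zero_mem' := ⟨Q.zero_mem, by simp⟩
  add_mem' := by
    rintro x y ⟨hx, hx'⟩ ⟨hy, hy'⟩
    exact ⟨Q.add_mem hx hy, fun z hz => by simp [hx' z hz, hy' z hz]⟩
  smul_mem' := by
    rintro c x ⟨hx, hx'⟩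
    exact ⟨Q.smul_mem c hx, fun z hz => by simp [hx' z hz]⟩

/-- In a finite-dimensional space, a functional that vanishes on the common kernel of a subspace
of functionals belongs to that subspace. -/
theorem exists_mem_eq_of_forall_orthogonal {K E : Type*} [Field K] [AddCommGroup E] [Module K E]
    [FiniteDimensional K E] (B : E →ₗ[K] E →ₗ[K] K) (Q A : Submodule K E) (u : E)
    (h : ∀ x ∈ Q, (∀ a ∈ A, B a x = 0) → B u x = 0) :
    ∃ a ∈ A, ∀ x ∈ Q, B u x = B a x := by
  let R : E →ₗ[K] Module.Dual K Q := (Q.subtype.dualMap) ∘ₗ B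
  have hu : R u ∈ A.map R := by
    rw [← Subspace.dualCoannihilator_dualAnnihilator_eq (W := A.map R),
      Submodule.mem_dualAnnihilator]
    intro x hx
    rw [Submodule.mem_dualCoannihilator] at hx
    exact h x x.2 fun a ha => hx (R a) (Submodule.mem_map_of_mem ha)
  obtain ⟨a, ha, hau⟩ := hu
  exact ⟨a, ha, fun x hx => (LinearMap.congr_fun hau ⟨x, hx⟩).symm⟩

/-- Both radicals have the same sum with `A`, and both meet `A` trivially. An element of the radical
on `Q` is orthogonal to `A`, so it splits as `a + s`, and `s` is then radical on `S`. Conversely, if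
`u` is radical on `S`, then `B u` vanishes on the orthogonal of `A` in `Q`; hence it agrees on `Q`
with `B a` for some `a` in `A`, and `u - a` is radical on `Q`. -/
theorem finrank_radOn_eq {K E : Type*} [Field K] [AddCommGroup E] [Module K E]
    [FiniteDimensional K E] (B : E →ₗ[K] E →ₗ[K] K) (hB : ∀ x y, B x y = - B y x)
    (Q A S : Submodule K E) (hA : A ≤ Q) (hS : S ≤ Q)
    (hSA : ∀ x ∈ S, ∀ y ∈ A, B x y = 0)
    (hperp : ∀ x ∈ Q, (∀ y ∈ A, B x y = 0) → x ∈ A ⊔ S)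
    (hdisj : A ⊓ S = ⊥) (hrad : A ⊓ radOn B Q = ⊥) :
    Module.finrank K (radOn B Q) = Module.finrank K (radOn B S) := by
  have hAS : A ⊓ radOn B S = ⊥ := by
    rw [eq_bot_iff, ← hdisj]
    exact inf_le_inf_left _ fun x hx => hx.1
  have hsup : A ⊔ radOn B Q = A ⊔ radOn B S := by
    apply le_antisymm
    · refine sup_le le_sup_left ?_
      rintro x ⟨hxQ, hx⟩
      obtain ⟨a, ha, s, hs, rfl⟩ := Submodule.mem_sup.1 (hperp x hxQ fun y hy => hx y (hA hy))
      refine Submodule.add_mem_sup ha ⟨hs, fun y hy => ?_⟩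
      have h1 := hx y (hS hy)
      have h2 : B a y = 0 := by rw [hB, hSA y hy a ha, neg_zero]
      simpa [h2] using h1
    · refine sup_le le_sup_left ?_
      rintro u ⟨huS, hu⟩
      obtain ⟨a, ha, hau⟩ := exists_mem_eq_of_forall_orthogonal B Q A u (by
        intro x hx hx'
        obtain ⟨a, ha, s, hs, rfl⟩ := Submodule.mem_sup.1
          (hperp x hx fun y hy => by rw [hB, hx' y hy, neg_zero])
        rw [map_add, hSA u huS a ha, hu s hs, add_zero])
      have h1 : u = a + (u - a) := by abel
      rw [h1]
      refine Submodule.add_mem_sup ha ⟨Q.sub_mem (hS huS) (hA ha), fun y hy => ?_⟩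
      simp [hau y hy]
  have h1 := Submodule.finrank_sup_add_finrank_inf_eq A (radOn B Q)
  have h2 := Submodule.finrank_sup_add_finrank_inf_eq A (radOn B S)
  rw [hrad] at h1
  rw [hAS, ← hsup] at h2
  omega

theorem finrank_map_eq_of_injOn {K E E' : Type*} [Field K] [AddCommGroup E] [Module K E]
    [AddCommGroup E'] [Module K E'] (f : E →ₗ[K] E') (P : Submodule K E)
    (hinj : ∀ x ∈ P, f x = 0 → x = 0) :
    Module.finrank K (P.map f) = Module.finrank K P := by
  have h1 : P.map f = LinearMap.range (f.domRestrict P) := by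
    rw [LinearMap.range_domRestrict]
  rw [h1]
  refine LinearMap.finrank_range_of_inj (LinearMap.ker_eq_bot.1 ?_)
  rw [LinearMap.ker_eq_bot']
  exact fun x hx => Subtype.ext (hinj x x.2 hx)

theorem finrank_radOn_map {K E E' : Type*} [Field K] [AddCommGroup E] [Module K E]
    [AddCommGroup E'] [Module K E'] (B : E →ₗ[K] E →ₗ[K] K) (B' : E' →ₗ[K] E' →ₗ[K] K)
    (f : E →ₗ[K] E') (S : Submodule K E) (S' : Submodule K E')
    (hmap : ∀ x ∈ S, f x ∈ S') (hsurj : ∀ y ∈ S', ∃ x ∈ S, f x = y)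
    (hinj : ∀ x ∈ S, f x = 0 → x = 0) (c : K) (hc : c ≠ 0)
    (hB : ∀ x ∈ S, ∀ y ∈ S, B' (f x) (f y) = c * B x y) :
    Module.finrank K (radOn B' S') = Module.finrank K (radOn B S) := by
  rw [← finrank_map_eq_of_injOn f (radOn B S) fun x hx => hinj x hx.1]
  suffices h : radOn B' S' = (radOn B S).map f by rw [h]
  ext z
  constructor
  · rintro ⟨hz, h⟩
    obtain ⟨x, hx, rfl⟩ := hsurj z hz
    refine ⟨x, ⟨hx, fun y hy => ?_⟩, rfl⟩
    have h1 := h (f y) (hmap y hy)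
    rw [hB x hx y hy] at h1
    exact (mul_eq_zero.1 h1).resolve_left hc
  · rintro ⟨x, hx, rfl⟩
    refine ⟨hmap x hx.1, fun y hy => ?_⟩
    obtain ⟨y, hy', rfl⟩ := hsurj y hy
    rw [hB x hx.1 y hy', hx.2 y hy', mul_zero]

/-- Presents the radical as the kernel of one linear map from `Q` to its dual, the form in which
semicontinuity applies. -/
theorem finrank_radOn_eq_ker {K E : Type*} [Field K] [AddCommGroup E] [Module K E]
    (B : E →ₗ[K] E →ₗ[K] K) (Q : Submodule K E) :
    Module.finrank K (radOn B Q) =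
      Module.finrank K (LinearMap.ker (Q.subtype.dualMap ∘ₗ B ∘ₗ Q.subtype)) := by
  rw [← finrank_map_eq_of_injOn Q.subtype _ fun x _ hx => Subtype.ext hx]
  suffices h : radOn B Q =
    (LinearMap.ker (Q.subtype.dualMap ∘ₗ B ∘ₗ Q.subtype)).map Q.subtype by rw [h]
  ext x
  constructor
  · rintro ⟨hx, h⟩
    exact ⟨⟨x, hx⟩, LinearMap.ext fun y => h y y.2, rfl⟩
  · rintro ⟨x, h, rfl⟩
    exact ⟨x.2, fun y hy => LinearMap.congr_fun h ⟨y, hy⟩⟩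

/-! ### Matrices supported on a relation and their index. -/

/-- The matrices supported on a relation. -/
def suppSub (K : Type*) [Field K] {ι : Type*} (r : ι → ι → Prop) :
    Submodule K (Matrix ι ι K) where
  carrier := {x | ∀ i j, ¬ r i j → x i j = 0}
  zero_mem' := by intro i j _; rfl
  add_mem' := by
    intro x y hx hy i j h
    simp [hx i j h, hy i j h]
  smul_mem' := by
    intro c x hx i j h
    simp [hx i j h]

theorem mem_suppSub {K : Type*} [Field K] {ι : Type*} {r : ι → ι → Prop} {x : Matrix ι ι K} :
    x ∈ suppSub K r ↔ ∀ i j, ¬ r i j → x i j = 0 := Iff.rfl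

/-- The form `(x, y) ↦ tr (F [x, y])` on square matrices. -/
def traceComm {K : Type*} [Field K] {ι : Type*} [Fintype ι] (F : Matrix ι ι K) :
    Matrix ι ι K →ₗ[K] Matrix ι ι K →ₗ[K] K :=
  LinearMap.mk₂ K (fun x y => Matrix.trace (F * (x * y - y * x)))
    (by intros; simp only [add_mul, mul_add, mul_sub, Matrix.trace_add, Matrix.trace_sub]; ring)
    (by intros; simp [mul_sub])
    (by intros; simp only [add_mul, mul_add, mul_sub, Matrix.trace_add, Matrix.trace_sub]; ring)
    (by intros; simp [mul_sub])

theorem traceComm_apply {K : Type*} [Field K] {ι : Type*} [Fintype ι] (F x y : Matrix ι ι K) :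
    traceComm F x y = Matrix.trace (F * (x * y - y * x)) := rfl

theorem traceComm_swap {K : Type*} [Field K] {ι : Type*} [Fintype ι] (F x y : Matrix ι ι K) :
    traceComm F x y = - traceComm F y x := by
  simp only [traceComm_apply, mul_sub, Matrix.trace_sub]
  ring

theorem traceComm_eq {K : Type*} [Field K] {ι : Type*} [Fintype ι] (F x y : Matrix ι ι K) :
    traceComm F x y = Matrix.trace ((F * x - x * F) * y) := by
  rw [traceComm_apply, mul_sub, sub_mul, Matrix.trace_sub, Matrix.trace_sub, mul_assoc,
    ← mul_assoc F y x, Matrix.trace_mul_comm (F * y) x, mul_assoc]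

/-- The kernel of the form `tr (F [x, y])` on the matrices supported on `r`. -/
abbrev relKer {K : Type*} [Field K] {ι : Type*} [Fintype ι] (r : ι → ι → Prop)
    (F : Matrix ι ι K) : Submodule K (Matrix ι ι K) :=
  radOn (traceComm F) (suppSub K r)

/-- The smallest dimension of the kernel of a form `tr (F [x, y])` on the matrices supported
on `r`. -/
noncomputable def relIndex (K : Type*) [Field K] {ι : Type*} [Fintype ι] (r : ι → ι → Prop) : ℕ :=
  sInf (Set.range fun F : Matrix ι ι K => Module.finrank K (relKer r F))

section
variable {K : Type*} [Field K] {ι : Type*} [Fintype ι]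

theorem relIndex_le (r : ι → ι → Prop) (F : Matrix ι ι K) :
    relIndex K r ≤ Module.finrank K (relKer r F) := Nat.sInf_le ⟨F, rfl⟩

theorem exists_relIndex_eq (r : ι → ι → Prop) :
    ∃ F : Matrix ι ι K, Module.finrank K (relKer r F) = relIndex K r :=
  Nat.sInf_mem (Set.range_nonempty fun F : Matrix ι ι K => Module.finrank K (relKer r F))

omit [Fintype ι] in
theorem suppSub_single_mem [DecidableEq ι] {r : ι → ι → Prop} {i j : ι} (h : r i j) (c : K) :
    Matrix.single i j c ∈ suppSub K r := by
  intro i' j' h'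
  rw [Matrix.single_apply, if_neg]
  rintro ⟨rfl, rfl⟩
  exact h' h

theorem trace_mul_eq_zero_of_suppSub {r : ι → ι → Prop} {M y : Matrix ι ι K}
    (hM : ∀ i j, r i j → M j i = 0) (hy : y ∈ suppSub K r) : Matrix.trace (M * y) = 0 := by
  rw [Matrix.trace]
  refine Finset.sum_eq_zero fun j _ => ?_
  rw [Matrix.diag_apply, Matrix.mul_apply]
  refine Finset.sum_eq_zero fun i _ => ?_
  by_cases h : r i j
  · rw [hM i j h, zero_mul]
  · rw [hy i j h, mul_zero]

theorem trace_mul_single' [DecidableEq ι] (M : Matrix ι ι K) (i j : ι) :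
    Matrix.trace (M * Matrix.single i j (1 : K)) = M j i := by
  simp [Matrix.trace_mul_single]

/-- Invariance of the trace makes the form the pairing of `[F, x]` with `y`, which is then tested on
matrix units. -/
theorem mem_relKer_iff {r : ι → ι → Prop} {F x : Matrix ι ι K} :
    x ∈ relKer r F ↔ x ∈ suppSub K r ∧ ∀ i j, r i j → (F * x - x * F) j i = 0 := by
  classical
  refine and_congr_right fun _ => ⟨fun h i j hij => ?_, fun h y hy => ?_⟩
  · rw [← trace_mul_single' (F * x - x * F) i j, ← traceComm_eq]
    exact h _ (suppSub_single_mem hij 1)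
  · rw [traceComm_eq]
    exact trace_mul_eq_zero_of_suppSub h hy

theorem suppSub_mul_mem {r : ι → ι → Prop} (hr : ∀ i j k, r i j → r j k → r i k)
    {x y : Matrix ι ι K} (hx : x ∈ suppSub K r) (hy : y ∈ suppSub K r) :
    x * y ∈ suppSub K r := by
  intro i k hik
  rw [Matrix.mul_apply]
  refine Finset.sum_eq_zero fun j _ => ?_
  by_cases h1 : r i j
  · rw [hy j k fun h2 => hik (hr i j k h1 h2), mul_zero]
  · rw [hx i j h1, zero_mul]

theorem le_finrank_relKer_of_infinite (r : ι → ι → Prop) (F D : Matrix ι ι K) (d : ℕ)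
    (h : {t : K | d ≤ Module.finrank K (relKer r (F + t • D))}.Infinite) :
    d ≤ Module.finrank K (relKer r F) := by
  rw [finrank_radOn_eq_ker]
  refine le_finrank_ker_of_infinite _ ((suppSub K r).subtype.dualMap ∘ₗ (traceComm D) ∘ₗ
    (suppSub K r).subtype) d (h.mono fun t ht => ?_)
  rw [Set.mem_ofPred_eq, finrank_radOn_eq_ker] at ht
  rw [Set.mem_ofPred_eq]
  have h1 : traceComm (F + t • D) = traceComm F + t • traceComm D := by
    ext x y
    simp [traceComm_apply, add_mul]
  rw [h1] at ht
  exact ht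

/-- Conjugation by units supported on `r` preserves the dimension of the kernel. -/
theorem finrank_relKer_conj [DecidableEq ι] {r : ι → ι → Prop}
    (hr : ∀ i j k, r i j → r j k → r i k) (F g g' : Matrix ι ι K)
    (hg : g ∈ suppSub K r) (hg' : g' ∈ suppSub K r) (h1 : g * g' = 1) (h2 : g' * g = 1) :
    Module.finrank K (relKer r (g * F * g')) = Module.finrank K (relKer r F) := by
  refine finrank_radOn_map (traceComm F) (traceComm (g * F * g'))
    (LinearMap.mulLeft K g ∘ₗ LinearMap.mulRight K g') (suppSub K r) _ ?_ ?_ ?_ 1 one_ne_zero ?_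
  · intro x hx
    exact suppSub_mul_mem hr hg (suppSub_mul_mem hr hx hg')
  · intro x hx
    refine ⟨g' * x * g, suppSub_mul_mem hr (suppSub_mul_mem hr hg' hx) hg, ?_⟩
    simp only [LinearMap.comp_apply, LinearMap.mulRight_apply, LinearMap.mulLeft_apply]
    rw [← mul_assoc, ← mul_assoc, ← mul_assoc, h1, one_mul, mul_assoc, h1, mul_one]
  · intro x _ hx
    simp only [LinearMap.comp_apply, LinearMap.mulRight_apply, LinearMap.mulLeft_apply] at hx
    have h3 : g' * (g * (x * g')) * g = x := by
      rw [← mul_assoc, h2, one_mul, mul_assoc, h2, mul_one]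
    rw [← h3, hx, mul_zero, zero_mul]
  · intro x _ y _
    have h4 : ∀ x y : Matrix ι ι K, g * (x * g') * (g * (y * g')) = g * (x * y) * g' := by
      intro x y
      calc g * (x * g') * (g * (y * g')) = g * x * (g' * g) * y * g' := by simp only [mul_assoc]
        _ = g * (x * y) * g' := by rw [h2, mul_one]; simp only [mul_assoc]
    simp only [LinearMap.comp_apply, LinearMap.mulRight_apply, LinearMap.mulLeft_apply]
    rw [one_mul, traceComm_apply, traceComm_apply, h4, h4, ← sub_mul, ← mul_sub,
      mul_assoc g F g', mul_assoc g (x * y - y * x) g', h4, Matrix.trace_mul_comm, ← mul_assoc,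
      h2, one_mul]

/-- Transposition reverses products, so it carries one commutator form to the negative of the other.
-/
theorem relIndex_flip (r : ι → ι → Prop) : relIndex K (fun i j => r j i) = relIndex K r := by
  have key : ∀ (r : ι → ι → Prop) (F : Matrix ι ι K),
      Module.finrank K (relKer (fun i j => r j i) F.transpose) =
        Module.finrank K (relKer r F) := by
    intro r F
    refine finrank_radOn_map (traceComm F) (traceComm F.transpose)
      { toFun := Matrix.transpose, map_add' := Matrix.transpose_add,
        map_smul' := Matrix.transpose_smul } _ _ (fun x hx i j h => hx j i h)
      (fun x hx => ⟨x.transpose, fun i j h => hx j i h, x.transpose_transpose⟩)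
      (fun x _ hx => by simpa using hx) (-1) (by simp) ?_
    intro x _ y _
    simp only [LinearMap.coe_mk, AddHom.coe_mk, traceComm_apply]
    rw [← Matrix.transpose_mul, ← Matrix.transpose_mul, ← Matrix.transpose_sub,
      ← Matrix.transpose_mul, Matrix.trace_transpose, Matrix.trace_mul_comm, neg_one_mul,
      ← Matrix.trace_neg, ← mul_neg, neg_sub]
  have le : ∀ r : ι → ι → Prop, relIndex K (fun i j => r j i) ≤ relIndex K r := by
    intro r
    obtain ⟨F, hF⟩ := exists_relIndex_eq (K := K) r
    rw [← hF, ← key]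
    exact relIndex_le _ _
  exact le_antisymm (le r) (le fun i j => r j i)

/-- Pulling back matrices along a map of indices, as a linear map. -/
def submatrixLinear {κ : Type*} (e : κ → ι) : Matrix ι ι K →ₗ[K] Matrix κ κ K where
  toFun x := x.submatrix e e
  map_add' x y := by
    ext
    rfl
  map_smul' c x := by
    ext
    rfl

omit [Fintype ι] in
theorem submatrixLinear_apply {κ : Type*} (e : κ → ι) (x : Matrix ι ι K) :
    submatrixLinear e x = x.submatrix e e := rfl

theorem relIndex_congr_equiv {κ : Type*} [Fintype κ] (e : ι ≃ κ) (r : ι → ι → Prop)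
    (s : κ → κ → Prop) (h : ∀ i j, r i j ↔ s (e i) (e j)) : relIndex K r = relIndex K s := by
  have key : ∀ F : Matrix ι ι K, Module.finrank K (relKer s (F.submatrix e.symm e.symm)) =
      Module.finrank K (relKer r F) := by
    intro F
    refine finrank_radOn_map (traceComm F) (traceComm (F.submatrix e.symm e.symm))
      (submatrixLinear e.symm) _ _ ?_ ?_ ?_ 1 one_ne_zero ?_
    · exact fun x hx i j hij => hx _ _ (by simpa [h] using hij)
    · refine fun x hx => ⟨x.submatrix e e, fun i j hij => hx _ _ (by rwa [← h]), ?_⟩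
      ext i j
      simp [submatrixLinear_apply]
    · intro x _ hx
      ext i j
      simpa [submatrixLinear_apply] using congrFun (congrFun hx (e i)) (e j)
    · intro x _ y _
      have hsub : ∀ M N : Matrix ι ι K, M.submatrix e.symm e.symm - N.submatrix e.symm e.symm =
          (M - N).submatrix e.symm e.symm := fun M N => by
        ext
        rfl
      rw [traceComm_apply, traceComm_apply, submatrixLinear_apply, submatrixLinear_apply,
        Matrix.submatrix_mul_equiv, Matrix.submatrix_mul_equiv, hsub,
        Matrix.submatrix_mul_equiv, one_mul]
      exact Equiv.sum_comp e.symm fun i => (F * (x * y - y * x)) i i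
  refine le_antisymm ?_ ?_
  · obtain ⟨G, hG⟩ := exists_relIndex_eq (K := K) s
    have h1 : (G.submatrix e e).submatrix e.symm e.symm = G := by
      ext i j
      simp
    rw [← hG, ← h1, key]
    exact relIndex_le _ _
  · obtain ⟨G, hG⟩ := exists_relIndex_eq (K := K) r
    rw [← hG, ← key]
    exact relIndex_le _ _

theorem exists_trace_mul_eq (l : Matrix ι ι K →ₗ[K] K) :
    ∃ G : Matrix ι ι K, ∀ y, l y = Matrix.trace (G * y) := by
  classical
  refine ⟨Matrix.of fun j i => l (Matrix.single i j 1), fun y => ?_⟩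
  have h : l = Matrix.traceLinearMap ι K K ∘ₗ
      LinearMap.mulLeft K (Matrix.of fun j i => l (Matrix.single i j 1)) := by
    refine Matrix.ext_linearMap _ fun i j => LinearMap.ext_ring ?_
    simp [Matrix.trace_mul_single]
  exact LinearMap.congr_fun h y

/-- Left multiplication by `g` is an injective endomorphism of the finite-dimensional space of
supported matrices, so it attains `1`. -/
theorem suppSub_inv_mem [DecidableEq ι] {r : ι → ι → Prop} (hr : ∀ i, r i i)
    (hr' : ∀ i j k, r i j → r j k → r i k) {g : Matrix ι ι K} (hg : g ∈ suppSub K r)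
    (hd : IsUnit g.det) : g⁻¹ ∈ suppSub K r := by
  let f : suppSub K r →ₗ[K] suppSub K r :=
    (LinearMap.mulLeft K g).restrict fun x hx => suppSub_mul_mem hr' hg hx
  have hinj : Function.Injective f := by
    intro x y hxy
    have h1 : g * x = g * y := congrArg Subtype.val hxy
    have h2 := congrArg (g⁻¹ * ·) h1
    simpa [Matrix.nonsing_inv_mul_cancel_left _ _ hd] using h2
  have h1mem : (1 : Matrix ι ι K) ∈ suppSub K r := by
    intro i j hij
    exact Matrix.one_apply_ne fun h => hij (h ▸ hr i)
  obtain ⟨g', hg'⟩ := LinearMap.surjective_of_injective hinj ⟨1, h1mem⟩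
  have h2 : g * g' = 1 := congrArg Subtype.val hg'
  rw [Matrix.inv_eq_right_inv h2]
  exact g'.2

end

/-! ### Reduction of the index along an abelian ideal. -/

section
variable {K : Type*} [Field K] {ι κ : Type*} [Fintype ι] [Fintype κ]

/-- The data of the reduction of a support relation `r` on `ι` to a relation `s` on `κ`. The
indices in `p` form a minimal class, whose products with larger indices span an abelian ideal;
`φ` identifies some of the indices in `p` with indices outside `p`. -/
structure IsReduction (r : ι → ι → Prop) (s : κ → κ → Prop) (p : ι → Prop) (φ : ι → κ) :
    Prop where
  refl : ∀ i, r i i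
  trans : ∀ i j k, r i j → r j k → r i k
  trans' : ∀ u v w, s u v → s v w → s u w
  full : ∀ i j, p i → p j → r i j
  noBack : ∀ i j, ¬ p i → p j → ¬ r i j
  inj : ∀ i j, (p i ↔ p j) → φ i = φ j → i = j
  lift : ∀ i j, (p i ↔ p j) → s (φ i) (φ j) → r i j
  rep : ∀ u v, s u v → ∃ i j, (p i ↔ p j) ∧ φ i = u ∧ φ j = v
  closed : ∀ i k v, (p i ↔ p k) → s (φ i) v → s v (φ k) → ∃ j, (p i ↔ p j) ∧ φ j = v
  matched : ∀ i j, p i → ¬ p j → φ i = φ j → r i j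
  -- Call `i` in `p` and `j` outside `p` partners if `φ i = φ j`. In `outer` and `inner`, an entry
  -- of a diagonal block not allowed by `s` must either vanish or equal an entry of the outer block,
  -- once `x` preserves the pairing of partners. `cross` makes lifts preserve that pairing;
  -- `unmatched` provides a partner of `i` that detects ideal positions whose column has none.
  outer : ∀ i j, ¬ p i → ¬ p j → r i j → s (φ i) (φ j) ∨
    ((∃ k, p k ∧ r k i ∧ φ k = φ j) ∧ ∀ k, p k → φ k ≠ φ i)
  inner : ∀ i k, p i → p k → s (φ k) (φ i) ∨ (∃ j, ¬ p j ∧ r i j ∧ φ k = φ j)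
  cross : ∀ i j, p i → ¬ p j → r i j → s (φ j) (φ i) →
    (∃ k, p k ∧ φ k = φ j) ∧ ∃ l, ¬ p l ∧ φ l = φ i
  unmatched : ∀ i j, p i → ¬ p j → r i j → (∀ k, p k → φ k ≠ φ j) →
    ∃ l, ¬ p l ∧ φ l = φ i ∧ r j l

open Classical in
/-- The matrix on `ι` whose diagonal blocks with respect to `p` are pulled back along `φ`. -/
noncomputable def liftMat (p : ι → Prop) (φ : ι → κ) : Matrix κ κ K →ₗ[K] Matrix ι ι K where
  toFun y := Matrix.of fun i j => if (p i ↔ p j) then y (φ i) (φ j) else 0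
  map_add' x y := by
    ext i j
    by_cases h : (p i ↔ p j) <;> simp [h]
  map_smul' c x := by
    ext i j
    by_cases h : (p i ↔ p j) <;> simp [h]

omit [Fintype ι] [Fintype κ] in
theorem liftMat_same {p : ι → Prop} {φ : ι → κ} (y : Matrix κ κ K) {i j : ι} (h : p i ↔ p j) :
    liftMat p φ y i j = y (φ i) (φ j) := if_pos h

omit [Fintype ι] [Fintype κ] in
theorem liftMat_diff {p : ι → Prop} {φ : ι → κ} (y : Matrix κ κ K) {i j : ι} (h : ¬ (p i ↔ p j)) :
    liftMat p φ y i j = 0 := if_neg h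

namespace IsReduction

variable {r : ι → ι → Prop} {s : κ → κ → Prop} {p : ι → Prop} {φ : ι → κ}

/-- By `closed`, every middle index that contributes to `y * z` comes from the class of the outer
indices, and from only one element of it by `inj`. -/
theorem liftMat_mul (h : IsReduction r s p φ) {y z : Matrix κ κ K} (hy : y ∈ suppSub K s)
    (hz : z ∈ suppSub K s) : liftMat p φ y * liftMat p φ z = liftMat p φ (y * z) := by
  classical
  ext i k
  rw [Matrix.mul_apply]
  by_cases hik : p i ↔ p k
  · rw [liftMat_same _ hik, Matrix.mul_apply, ← Finset.sum_filter_add_sum_filter_not _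
      (fun j => p i ↔ p j), Finset.sum_eq_zero (s := Finset.univ.filter fun j => ¬ (p i ↔ p j)),
      add_zero]
    · refine Finset.sum_of_injOn φ ?_ (by simp) ?_ ?_
      · intro j hj j' hj' hjj
        simp only [Finset.coe_filter, Finset.mem_univ, true_and, Set.mem_ofPred_eq] at hj hj'
        exact h.inj _ _ (hj.symm.trans hj') hjj
      · intro v _ hv
        by_contra hne
        obtain ⟨j, hj, rfl⟩ := h.closed i k v hik
          (by_contra fun h1 => hne (by rw [hy _ _ h1, zero_mul]))
          (by_contra fun h1 => hne (by rw [hz _ _ h1, mul_zero]))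
        exact hv ⟨j, by simpa using hj, rfl⟩
      · intro j hj
        rw [Finset.mem_filter] at hj
        rw [liftMat_same _ hj.2, liftMat_same _ (hj.2.symm.trans hik)]
    · intro j hj
      rw [Finset.mem_filter] at hj
      rw [liftMat_diff _ hj.2, zero_mul]
  · rw [liftMat_diff _ hik]
    refine Finset.sum_eq_zero fun j _ => ?_
    by_cases hij : p i ↔ p j
    · rw [liftMat_diff (i := j) _ fun h => hik (hij.trans h), mul_zero]
    · rw [liftMat_diff _ hij, zero_mul]

omit [Fintype ι] [Fintype κ] in
theorem liftMat_mem (h : IsReduction r s p φ) {y : Matrix κ κ K} (hy : y ∈ suppSub K s) :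
    liftMat p φ y ∈ suppSub K r := by
  intro i j hij
  by_cases hp : p i ↔ p j
  · rw [liftMat_same _ hp]
    exact hy _ _ fun hs => hij (h.lift _ _ hp hs)
  · exact liftMat_diff _ hp

omit [Fintype ι] [Fintype κ] in
theorem eq_zero_of_liftMat (h : IsReduction r s p φ) {y : Matrix κ κ K} (hy : y ∈ suppSub K s)
    (h0 : liftMat p φ y = 0) : y = 0 := by
  ext u v
  by_cases hs : s u v
  · obtain ⟨i, j, hij, rfl, rfl⟩ := h.rep u v hs
    rw [← liftMat_same (p := p) y hij, h0]
    rfl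
  · exact hy _ _ hs

/-- The normal form on the abelian ideal. -/
def Normal (r : ι → ι → Prop) (p : ι → Prop) (φ : ι → κ) (F : Matrix ι ι K) : Prop :=
  ∀ i j, p i → ¬ p j → r i j → (φ i = φ j → F j i = 1) ∧ (φ i ≠ φ j → F j i = 0)

-- In normal form, `F` pairs each index with its partner alone. As `x` has no entries from outside
-- `p` into `p`, an entry of `F * x` or `x * F` dual to an ideal position is a single entry of `x`,
-- or zero when there is no partner. The next lemmas treat these cases.
omit [Fintype κ] in
theorem mul_apply_of_rep (h : IsReduction r s p φ) {F x : Matrix ι ι K} (hF : Normal r p φ F)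
    (hx : x ∈ suppSub K r) {i j k : ι} (hi : p i) (hj : ¬ p j) (hij : r i j) (hk : p k)
    (hkj : φ k = φ j) : (F * x) j i = x k i := by
  rw [Matrix.mul_apply, Finset.sum_eq_single k]
  · rw [(hF k j hk hj (h.trans _ _ _ (h.full _ _ hk hi) hij)).1 hkj, one_mul]
  · intro l _ hl
    by_cases hpl : p l
    · rw [(hF l j hpl hj (h.trans _ _ _ (h.full _ _ hpl hi) hij)).2, zero_mul]
      exact fun h1 => hl (h.inj _ _ (by simp [hpl, hk]) (h1.trans hkj.symm))
    · rw [hx _ _ (h.noBack _ _ hpl hi), mul_zero]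
  · simp

omit [Fintype κ] in
theorem mul_apply_of_no_rep (h : IsReduction r s p φ) {F x : Matrix ι ι K} (hF : Normal r p φ F)
    (hx : x ∈ suppSub K r) {i j : ι} (hi : p i) (hj : ¬ p j) (hij : r i j)
    (hk : ∀ k, p k → φ k ≠ φ j) : (F * x) j i = 0 := by
  rw [Matrix.mul_apply]
  refine Finset.sum_eq_zero fun l _ => ?_
  by_cases hpl : p l
  · rw [(hF l j hpl hj (h.trans _ _ _ (h.full _ _ hpl hi) hij)).2 (hk l hpl), zero_mul]
  · rw [hx _ _ (h.noBack _ _ hpl hi), mul_zero]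

omit [Fintype κ] in
theorem apply_mul_of_rep (h : IsReduction r s p φ) {F x : Matrix ι ι K} (hF : Normal r p φ F)
    (hx : x ∈ suppSub K r) {i j l : ι} (hi : p i) (hj : ¬ p j) (hij : r i j) (hl : ¬ p l)
    (hli : φ i = φ l) : (x * F) j i = x j l := by
  rw [Matrix.mul_apply, Finset.sum_eq_single l]
  · rw [(hF i l hi hl (h.matched _ _ hi hl hli)).1 hli, mul_one]
  · intro k _ hk
    by_cases hjk : r j k
    · have hpk : ¬ p k := fun hpk => h.noBack _ _ hj hpk hjk
      rw [(hF i k hi hpk (h.trans _ _ _ hij hjk)).2, mul_zero]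
      exact fun h1 => hk (h.inj _ _ (by simp [hpk, hl]) (h1.symm.trans hli))
    · rw [hx _ _ hjk, zero_mul]
  · simp

omit [Fintype κ] in
theorem apply_mul_of_no_rep (h : IsReduction r s p φ) {F x : Matrix ι ι K} (hF : Normal r p φ F)
    (hx : x ∈ suppSub K r) {i j : ι} (hi : p i) (hj : ¬ p j) (hij : r i j)
    (hl : ∀ l, ¬ p l → φ l ≠ φ i) : (x * F) j i = 0 := by
  rw [Matrix.mul_apply]
  refine Finset.sum_eq_zero fun k _ => ?_
  by_cases hjk : r j k
  · have hpk : ¬ p k := fun hpk => h.noBack _ _ hj hpk hjk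
    rw [(hF i k hi hpk (h.trans _ _ _ hij hjk)).2 (hl k hpk).symm, mul_zero]
  · rw [hx _ _ hjk, zero_mul]

omit [Fintype κ] in
/-- A matrix orthogonal to the abelian ideal is, up to the ideal, a lift. -/
theorem exists_lift (h : IsReduction r s p φ) {F x : Matrix ι ι K} (hF : Normal r p φ F)
    (hx : x ∈ suppSub K r)
    (hperp : ∀ i j, p i → ¬ p j → r i j → (F * x) j i = (x * F) j i) :
    ∃ y ∈ suppSub K s, ∀ i j, (p i ↔ p j) → x i j = y (φ i) (φ j) := by
  classical
  -- At the ideal position `(i, j)` the two sides of `hperp` are `x k i` and `x j l`: the copies of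
  -- one entry in the two diagonal blocks coincide.
  have hcons : ∀ k i j l, p k → p i → ¬ p j → ¬ p l → φ k = φ j → φ i = φ l →
      x k i = x j l := by
    intro k i j l hk hi hj hl hkj hil
    have hij : r i j := h.trans _ _ _ (h.full _ _ hi hk) (h.matched _ _ hk hj hkj)
    rw [← h.mul_apply_of_rep hF hx hi hj hij hk hkj, hperp i j hi hj hij,
      h.apply_mul_of_rep hF hx hi hj hij hl hil]
  have hcons' : ∀ i j i' j', (p i ↔ p j) → (p i' ↔ p j') → φ i = φ i' → φ j = φ j' →
      x i j = x i' j' := by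
    intro i j i' j' hij hij' hi hj
    by_cases h1 : p i ↔ p i'
    · rw [h.inj i i' h1 hi, h.inj j j' (hij.symm.trans (h1.trans hij')) hj]
    · by_cases h2 : p i
      · exact hcons _ _ _ _ h2 (hij.1 h2) (by tauto) (by tauto) hi hj
      · exact (hcons _ _ _ _ (by tauto) (by tauto) h2 (by tauto) hi.symm hj.symm).symm
  have houter : ∀ i j, ¬ p i → ¬ p j → x i j ≠ 0 → s (φ i) (φ j) := by
    intro i j hi hj hne
    have hij : r i j := by_contra fun h1 => hne (hx _ _ h1)
    refine (h.outer i j hi hj hij).resolve_right ?_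
    rintro ⟨⟨k, hk, hki, hkj⟩, hno⟩
    apply hne
    rw [← h.apply_mul_of_rep hF hx hk hi hki hj hkj, ← hperp k i hk hi hki,
      h.mul_apply_of_no_rep hF hx hk hi hki hno]
  have hinner : ∀ k i, p k → p i → x k i ≠ 0 → s (φ k) (φ i) := by
    intro k i hk hi hne
    obtain h1 | ⟨j, hj, hij, hkj⟩ := h.inner i k hi hk
    · exact h1
    by_cases hl : ∃ l, ¬ p l ∧ φ i = φ l
    · obtain ⟨l, hl, hil⟩ := hl
      rw [hkj, hil]
      exact houter j l hj hl (by rwa [← hcons k i j l hk hi hj hl hkj hil])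
    · exfalso
      apply hne
      push Not at hl
      rw [← h.mul_apply_of_rep hF hx hi hj hij hk hkj, hperp i j hi hj hij,
        h.apply_mul_of_no_rep hF hx hi hj hij fun l hl' => (hl l hl').symm]
  let y : Matrix κ κ K := Matrix.of fun u v =>
    if h : ∃ q : ι × ι, (p q.1 ↔ p q.2) ∧ φ q.1 = u ∧ φ q.2 = v then
      x h.choose.1 h.choose.2 else 0
  have hy : ∀ i j, (p i ↔ p j) → x i j = y (φ i) (φ j) := by
    intro i j hij
    have hex : ∃ q : ι × ι, (p q.1 ↔ p q.2) ∧ φ q.1 = φ i ∧ φ q.2 = φ j := ⟨(i, j), hij, rfl, rfl⟩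
    simp only [y, Matrix.of_apply, dif_pos hex]
    exact hcons' _ _ _ _ hij hex.choose_spec.1 hex.choose_spec.2.1.symm
      hex.choose_spec.2.2.symm
  refine ⟨y, fun u v huv => ?_, hy⟩
  by_cases hex : ∃ q : ι × ι, (p q.1 ↔ p q.2) ∧ φ q.1 = u ∧ φ q.2 = v
  · obtain ⟨⟨i, j⟩, hij, rfl, rfl⟩ := hex
    rw [← hy i j hij]
    by_contra hne
    by_cases hi : p i
    · exact huv (hinner i j hi (hij.1 hi) hne)
    · exact huv (houter i j hi (by tauto) hne)
  · simp only [y, Matrix.of_apply, dif_neg hex]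

/-- This is `finrank_radOn_eq` with `A` the abelian ideal and `S` the lifts. `cross` makes `S`
orthogonal to `A`, `exists_lift` puts the orthogonal of `A` inside `A + S`, and the pairing of
partners keeps `A` away from the radical. Lifting is multiplicative, so the form on `S` is that of
`G`. -/
theorem finrank_relKer_eq (h : IsReduction r s p φ) {F : Matrix ι ι K} (hF : Normal r p φ F)
    {G : Matrix κ κ K}
    (hG : ∀ y ∈ suppSub K s, Matrix.trace (F * liftMat p φ y) = Matrix.trace (G * y)) :
    Module.finrank K (relKer r F) = Module.finrank K (relKer s G) := by
  classical
  let A : Submodule K (Matrix ι ι K) := suppSub K fun i j => p i ∧ ¬ p j ∧ r i j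
  let S : Submodule K (Matrix ι ι K) := (suppSub K s).map (liftMat p φ)
  have hA : A ≤ suppSub K r := fun x hx i j hij => hx i j fun h1 => hij h1.2.2
  have hS : S ≤ suppSub K r := by
    rintro _ ⟨y, hy, rfl⟩
    exact h.liftMat_mem hy
  rw [show Module.finrank K (relKer s G) = Module.finrank K (radOn (traceComm F) S) from ?_]
  · refine finrank_radOn_eq (traceComm F) (traceComm_swap F) (suppSub K r) A S hA hS ?_ ?_ ?_ ?_
    · rintro _ ⟨u, hu, rfl⟩ y hy
      rw [traceComm_eq]
      refine trace_mul_eq_zero_of_suppSub ?_ hy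
      rintro i j ⟨hi, hj, hij⟩
      rw [Matrix.sub_apply, sub_eq_zero]
      have hm := h.liftMat_mem hu
      by_cases hs : s (φ j) (φ i)
      · obtain ⟨⟨k, hk, hkj⟩, l, hl, hli⟩ := h.cross i j hi hj hij hs
        rw [h.mul_apply_of_rep hF hm hi hj hij hk hkj,
          h.apply_mul_of_rep hF hm hi hj hij hl hli.symm,
          liftMat_same _ (by simp [hk, hi]), liftMat_same _ (by simp [hj, hl]), hkj, hli]
      · have h1 : (F * liftMat p φ u) j i = 0 := by
          by_cases hk : ∃ k, p k ∧ φ k = φ j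
          · obtain ⟨k, hk, hkj⟩ := hk
            rw [h.mul_apply_of_rep hF hm hi hj hij hk hkj, liftMat_same _ (by simp [hk, hi]), hkj,
              hu _ _ hs]
          · push Not at hk
            exact h.mul_apply_of_no_rep hF hm hi hj hij hk
        have h2 : (liftMat p φ u * F) j i = 0 := by
          by_cases hl : ∃ l, ¬ p l ∧ φ l = φ i
          · obtain ⟨l, hl, hli⟩ := hl
            rw [h.apply_mul_of_rep hF hm hi hj hij hl hli.symm, liftMat_same _ (by simp [hj, hl]),
              hli, hu _ _ hs]
          · push Not at hl
            exact h.apply_mul_of_no_rep hF hm hi hj hij hl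
        rw [h1, h2]
    · intro x hx hperp
      obtain ⟨y, hy, hxy⟩ := h.exists_lift hF hx (by
        intro i j hi hj hij
        have h1 := hperp (Matrix.single i j 1) (suppSub_single_mem ⟨hi, hj, hij⟩ 1)
        rw [traceComm_eq, trace_mul_single', Matrix.sub_apply, sub_eq_zero] at h1
        exact h1)
      have h1 : x = (x - liftMat p φ y) + liftMat p φ y := by abel
      rw [h1]
      refine Submodule.add_mem_sup ?_ ⟨y, hy, rfl⟩
      intro i j hij
      rw [Matrix.sub_apply]
      by_cases hp : p i ↔ p j
      · rw [liftMat_same _ hp, hxy i j hp, sub_self]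
      · rw [liftMat_diff _ hp, sub_zero]
        refine hx _ _ fun hr => hij ?_
        by_cases hi : p i
        · exact ⟨hi, by tauto, hr⟩
        · exact absurd hr (h.noBack _ _ hi (by tauto))
    · rw [eq_bot_iff]
      rintro _ ⟨hxA, y, hy, rfl⟩
      rw [Submodule.mem_bot]
      ext i j
      by_cases hp : p i ↔ p j
      · exact hxA i j (by tauto)
      · exact liftMat_diff _ hp
    · rw [eq_bot_iff]
      rintro x ⟨hxA, hx⟩
      replace hx := mem_relKer_iff.1 hx
      rw [Submodule.mem_bot]
      ext i j
      by_cases hij : p i ∧ ¬ p j ∧ r i j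
      · obtain ⟨hi, hj, hij⟩ := hij
        -- An entry `x i j` of a radical element in the ideal is isolated by testing at `(l, i)`,
        -- with `l` the partner of `j`, or else at `(j, l)`, with `l` the partner of `i`.
        by_cases hl : ∃ l, p l ∧ φ l = φ j
        · obtain ⟨l, hl, hlj⟩ := hl
          have h1 := hx.2 l i (h.full _ _ hl hi)
          rw [Matrix.sub_apply, Matrix.mul_apply, Finset.sum_eq_zero, zero_sub, neg_eq_zero,
            Matrix.mul_apply, Finset.sum_eq_single j] at h1
          · rwa [(hF l j hl hj (h.matched _ _ hl hj hlj)).1 hlj, mul_one] at h1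
          · intro k _ hkj
            by_cases hik : p i ∧ ¬ p k ∧ r i k
            · rw [(hF l k hl hik.2.1 (h.trans _ _ _ (h.full _ _ hl hi) hik.2.2)).2, mul_zero]
              exact fun h2 => hkj (h.inj _ _ (by simp [hik.2.1, hj]) (h2.symm.trans hlj))
            · rw [hxA _ _ hik, zero_mul]
          · simp
          · intro k _
            rw [hxA k l (by tauto), mul_zero]
        · push Not at hl
          obtain ⟨l, hl, hli, hjl⟩ := h.unmatched i j hi hj hij hl
          have h1 := hx.2 j l hjl
          rw [Matrix.sub_apply, Matrix.mul_apply, Matrix.mul_apply,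
            Finset.sum_eq_zero (f := fun k => x l k * F k j), sub_zero,
            Finset.sum_eq_single i] at h1
          · rwa [(hF i l hi hl (h.matched _ _ hi hl hli.symm)).1 hli.symm, one_mul] at h1
          · intro k _ hki
            by_cases hkj : p k ∧ ¬ p j ∧ r k j
            · rw [(hF k l hkj.1 hl (h.trans _ _ _ hkj.2.2 hjl)).2, zero_mul]
              exact fun h2 => hki (h.inj _ _ (by simp [hkj.1, hi]) (h2.trans hli))
            · rw [hxA _ _ hkj, mul_zero]
          · simp
          · intro k _
            rw [hxA l k (by tauto), zero_mul]
      · exact hxA _ _ hij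
  · symm
    refine finrank_radOn_map (traceComm G) (traceComm F) (liftMat p φ) (suppSub K s) S
      (fun x hx => ⟨x, hx, rfl⟩) (fun x hx => hx) (fun x hx => h.eq_zero_of_liftMat hx) 1
      one_ne_zero ?_
    intro x hx y hy
    rw [traceComm_apply, traceComm_apply, h.liftMat_mul hx hy, h.liftMat_mul hy hx, ← map_sub,
      hG _ (Submodule.sub_mem _ (suppSub_mul_mem h.trans' hx hy) (suppSub_mul_mem h.trans' hy hx)),
      one_mul]

end IsReduction

end

section
variable {K : Type*} [Field K] {ι κ : Type*} [Fintype ι] [Fintype κ]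

namespace IsReduction

variable {r : ι → ι → Prop} {s : κ → κ → Prop} {p : ι → Prop} {φ : ι → κ}

theorem relIndex_le (h : IsReduction r s p φ) : relIndex K r ≤ relIndex K s := by
  classical
  obtain ⟨G, hG⟩ := exists_relIndex_eq (K := K) s
  -- The ideal part is normal, and the diagonal blocks carry `G`. Where an entry of `G` has copies
  -- in both blocks, only the outer copy is kept, so that `tr (F * liftMat y)` counts it once.
  let F : Matrix ι ι K := Matrix.of fun j i =>
    if p i then
      if p j then
        if (∃ l, ¬ p l ∧ φ l = φ i) ∧ (∃ l, ¬ p l ∧ φ l = φ j) then 0 else G (φ j) (φ i)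
      else if φ i = φ j then 1 else 0
    else if p j then 0 else G (φ j) (φ i)
  have hF : Normal r p φ F := by
    intro i j hi hj _
    simp [F, hi, hj]
  rw [← hG, ← h.finrank_relKer_eq hF]
  · exact _root_.relIndex_le r F
  intro y hy
  simp only [Matrix.trace, Matrix.diag_apply, Matrix.mul_apply]
  rw [← Finset.sum_product', ← Finset.sum_product',
    ← Finset.sum_filter_add_sum_filter_not _ (fun q : ι × ι => (p q.1 ↔ p q.2) ∧
      ¬ (p q.1 ∧ (∃ l, ¬ p l ∧ φ l = φ q.2) ∧ (∃ l, ¬ p l ∧ φ l = φ q.1))),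
    Finset.sum_eq_zero (s := Finset.filter (fun q : ι × ι => ¬ ((p q.1 ↔ p q.2) ∧
      ¬ (p q.1 ∧ (∃ l, ¬ p l ∧ φ l = φ q.2) ∧ (∃ l, ¬ p l ∧ φ l = φ q.1)))) _), add_zero]
  · refine Finset.sum_of_injOn (fun q => (φ q.1, φ q.2)) ?_ (by simp) ?_ ?_
    · rintro ⟨j, i⟩ h1 ⟨j', i'⟩ h2 heq
      simp only [Finset.coe_filter, Finset.mem_product, Finset.mem_univ, true_and,
        Set.mem_ofPred_eq, and_self] at h1 h2
      simp only [Prod.mk.injEq] at heq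
      -- Of two copies in different blocks, the one in `p` is excluded by the filter.
      have hjj : p j ↔ p j' := by
        by_contra hne
        by_cases hj : p j
        · exact h1.2 ⟨hj, ⟨i', by tauto, heq.2.symm⟩, j', by tauto, heq.1.symm⟩
        · exact h2.2 ⟨by tauto, ⟨i, by tauto, heq.2⟩, j, by tauto, heq.1⟩
      rw [h.inj j j' hjj heq.1, h.inj i i' (h1.1.symm.trans (hjj.trans h2.1)) heq.2]
    · rintro ⟨u, v⟩ _ hnot
      by_cases hs : s v u
      · exfalso
        obtain ⟨i, j, hij, rfl, rfl⟩ := h.rep v u hs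
        by_cases hex : p i ∧ (∃ l, ¬ p l ∧ φ l = φ i) ∧ (∃ l, ¬ p l ∧ φ l = φ j)
        · obtain ⟨hi, ⟨l, hl, hli⟩, m, hm, hmj⟩ := hex
          exact hnot ⟨(m, l), by simp [hm, hl], by simp [hli, hmj]⟩
        · refine hnot ⟨(j, i), ?_, rfl⟩
          simp only [Finset.coe_filter, Finset.mem_product, Finset.mem_univ, true_and,
            Set.mem_ofPred_eq, and_self]
          exact ⟨hij.symm, fun h2 => hex ⟨hij.2 h2.1, h2.2⟩⟩
      · rw [hy _ _ hs, mul_zero]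
    · rintro ⟨j, i⟩ h1
      simp only [Finset.mem_filter, Finset.mem_product, Finset.mem_univ, true_and, and_self] at h1
      rw [liftMat_same _ h1.1.symm]
      congr 1
      by_cases hi : p i
      · have hj := h1.1.2 hi
        simp only [F, Matrix.of_apply, if_pos hi, if_pos hj]
        exact if_neg fun h2 => h1.2 ⟨hj, h2⟩
      · have hj : ¬ p j := fun hj => hi (h1.1.1 hj)
        simp only [F, Matrix.of_apply, if_neg hi, if_neg hj]
  · rintro ⟨j, i⟩ h1
    simp only [Finset.mem_filter, Finset.mem_product, Finset.mem_univ, true_and, and_self] at h1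
    by_cases hij : p j ↔ p i
    · have h2 : p j ∧ (∃ l, ¬ p l ∧ φ l = φ i) ∧ (∃ l, ¬ p l ∧ φ l = φ j) := by tauto
      simp only [F, Matrix.of_apply, if_pos h2.1, if_pos (hij.1 h2.1), if_pos h2.2, zero_mul]
    · rw [liftMat_diff _ fun h2 => hij h2.symm, mul_zero]

/-- When its matched block is invertible, a form becomes normal after two conjugations by supported
units: the first makes that block the identity, the second clears the unmatched rows. An arbitrary
form is a limit of such forms `F + t D`, and semicontinuity concludes. -/
theorem relIndex_ge [Infinite K] (h : IsReduction r s p φ) : relIndex K s ≤ relIndex K r := by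
  classical
  -- forms that can be brought into normal form on the ideal
  have hnormal : ∀ F : Matrix ι ι K, Normal r p φ F →
      relIndex K s ≤ Module.finrank K (relKer r F) := by
    intro F hF
    obtain ⟨G, hG⟩ := exists_trace_mul_eq ((Matrix.traceLinearMap ι K K ∘ₗ
      LinearMap.mulLeft K F) ∘ₗ liftMat p φ)
    rw [h.finrank_relKer_eq hF (G := G) fun y _ => hG y]
    exact _root_.relIndex_le s G
  have hmatched : ∀ F : Matrix ι ι K,
      (∀ i j k, p i → p k → ¬ p j → φ k = φ j → F j i = if i = k then 1 else 0) →
      relIndex K s ≤ Module.finrank K (relKer r F) := by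
    intro F hF
    let C : ι → ι → Prop := fun j l => ¬ p j ∧ ¬ p l ∧ (∃ i, p i ∧ r i j) ∧
      (∀ k, p k → φ k ≠ φ j) ∧ ∃ k, p k ∧ φ k = φ l
    -- Row elimination: the matched rows restrict to unit vectors on the relevant columns, so
    -- subtracting `F j k` times the row of the partner of `k` clears the unmatched row `j`. Rows
    -- `j` are unmatched and columns `l` matched, whence `X * X = 0`.
    let X : Matrix ι ι K := Matrix.of fun j l =>
      if C j l then ∑ k, if p k ∧ φ k = φ l then F j k else 0 else 0
    have hX : X ∈ suppSub K r := by
      intro j l hjl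
      refine if_neg ?_
      rintro ⟨hj, hl, ⟨i, hi, hij⟩, hno, k, hk, hkl⟩
      obtain ⟨l', hl', hlk, hjl'⟩ := h.unmatched k j hk hj (h.trans _ _ _ (h.full _ _ hk hi) hij) hno
      rw [h.inj l' l (by simp [hl, hl']) (hlk.trans hkl)] at hjl'
      exact hjl hjl'
    have hXX : X * X = 0 := by
      ext j l
      rw [Matrix.mul_apply]
      refine Finset.sum_eq_zero fun m _ => ?_
      by_cases h1 : C j m
      · have h2 : ¬ C m l := by
          rintro ⟨-, -, -, hno, -⟩
          obtain ⟨-, -, -, -, k, hk, hkm⟩ := h1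
          exact hno k hk hkm
        rw [show X m l = 0 from if_neg h2, mul_zero]
      · rw [show X j m = 0 from if_neg h1, zero_mul]
    have h1mem : (1 : Matrix ι ι K) ∈ suppSub K r := fun i j hij =>
      Matrix.one_apply_ne fun h1 => hij (h1 ▸ h.refl i)
    rw [← finrank_relKer_conj h.trans F (1 - X) (1 + X) (Submodule.sub_mem _ h1mem hX)
      (Submodule.add_mem _ h1mem hX) (by noncomm_ring; simp [hXX]) (by noncomm_ring; simp [hXX])]
    refine hnormal _ ?_
    intro i j hi hj hij
    have hval : ((1 - X) * F * (1 + X)) j i = F j i - ∑ l, X j l * F l i := by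
      have hXi : ∀ l, X l i = 0 := fun l => if_neg fun h1 => h1.2.1 hi
      rw [Matrix.mul_add, Matrix.mul_one, Matrix.add_apply, Matrix.mul_apply (N := X),
        Finset.sum_eq_zero, add_zero, Matrix.sub_mul, Matrix.one_mul, Matrix.sub_apply,
        Matrix.mul_apply]
      intro l _
      rw [hXi, mul_zero]
    rw [hval]
    by_cases hk : ∃ k, p k ∧ φ k = φ j
    · obtain ⟨k, hk, hkj⟩ := hk
      have h0 : ∀ l, X j l = 0 := fun l => if_neg fun h1 => h1.2.2.2.1 k hk hkj
      rw [Finset.sum_eq_zero fun l _ => by rw [h0, zero_mul], sub_zero, hF i j k hi hk hj hkj]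
      refine ⟨fun h1 => if_pos (h.inj _ _ (by simp [hi, hk]) (h1.trans hkj.symm)), fun h1 => ?_⟩
      rw [if_neg]
      rintro rfl
      exact h1 hkj
    · push Not at hk
      refine ⟨fun h1 => absurd h1 (hk i hi), fun _ => ?_⟩
      obtain ⟨l, hl, hli, -⟩ := h.unmatched i j hi hj hij hk
      have hC : C j l := ⟨hj, hl, ⟨i, hi, hij⟩, hk, i, hi, hli.symm⟩
      rw [Finset.sum_eq_single l]
      · rw [hF i l i hi hi hl hli.symm, if_pos rfl, mul_one, show X j l = _ from if_pos hC,
          Finset.sum_eq_single i]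
        · rw [if_pos ⟨hi, hli.symm⟩, sub_self]
        · intro m _ hm
          rw [if_neg]
          rintro ⟨hpm, hml⟩
          exact hm (h.inj _ _ (by simp [hi, hpm]) (hml.trans hli))
        · simp
      · intro m _ hm
        by_cases hCm : C j m
        · obtain ⟨-, hpm, -, -, k, hk', hkm⟩ := hCm
          rw [hF i m k hi hk' hpm hkm, if_neg, mul_zero]
          rintro rfl
          exact hm (h.inj _ _ (by simp [hl, hpm]) (hkm.symm.trans hli.symm))
        · rw [show X j m = 0 from if_neg hCm, zero_mul]
      · simp
  -- the block of `F` pairing matched indices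
  let D : Matrix ι ι K := Matrix.of fun j i => if p i ∧ ¬ p j ∧ φ i = φ j then 1 else 0
  let P : Matrix ι ι K → Matrix ι ι K := fun F => Matrix.of fun i k =>
    ∑ j, if p i ∧ p k ∧ ¬ p j ∧ φ i = φ j then F j k else 0
  -- The matched block of `F`, indexed by `p` on both sides through partners and completed by
  -- identity rows. In the conjugate by `H F`, the row of the partner of `k` is row `k` of `H F * (H
  -- F)⁻¹` on `p`.
  let H : Matrix ι ι K → Matrix ι ι K := fun F => Matrix.of fun i k =>
    if p i ∧ ∃ j, ¬ p j ∧ φ i = φ j then P F i k else (1 : Matrix ι ι K) i k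
  have hunit : ∀ F : Matrix ι ι K, IsUnit (H F).det →
      relIndex K s ≤ Module.finrank K (relKer r F) := by
    intro F hF
    have hmem : H F ∈ suppSub K r := by
      intro i k hik
      simp only [H, P, Matrix.of_apply]
      split_ifs with h1
      · refine Finset.sum_eq_zero fun j _ => if_neg fun h2 => hik (h.full _ _ h2.1 h2.2.1)
      · exact Matrix.one_apply_ne fun h1 => hik (h1 ▸ h.refl i)
    have hmem' := suppSub_inv_mem h.refl h.trans hmem hF
    rw [← finrank_relKer_conj h.trans F (H F) (H F)⁻¹ hmem hmem' (Matrix.mul_nonsing_inv _ hF)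
      (Matrix.nonsing_inv_mul _ hF)]
    refine hmatched _ ?_
    intro i j k hi hk hj hkj
    have hrow : ∀ m, (H F * F) j m = F j m := by
      intro m
      rw [Matrix.mul_apply, Finset.sum_eq_single j]
      · simp [H, hj]
      · intro l _ hl
        simp [H, hj, Matrix.one_apply_ne hl.symm]
      · simp
    have hone : (H F * (H F)⁻¹) k i = if i = k then 1 else 0 := by
      rw [Matrix.mul_nonsing_inv _ hF, Matrix.one_apply]
      simp [eq_comm]
    rw [← hone, Matrix.mul_apply, Matrix.mul_apply]
    refine Finset.sum_congr rfl fun m _ => ?_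
    by_cases hm : p m
    · rw [hrow]
      congr 1
      simp only [H, P, Matrix.of_apply]
      rw [if_pos ⟨hk, j, hj, hkj⟩, Finset.sum_eq_single j]
      · rw [if_pos ⟨hk, hm, hj, hkj⟩]
      · intro l _ hl
        rw [if_neg]
        rintro ⟨-, -, hpl, hkl⟩
        exact hl (h.inj _ _ (by simp [hpl, hj]) (hkl.symm.trans hkj))
      · simp
    · rw [hmem' _ _ (h.noBack _ _ hm hi), mul_zero, mul_zero]
  obtain ⟨F, hF⟩ := exists_relIndex_eq (K := K) r
  rw [← hF]
  refine le_finrank_relKer_of_infinite r F D _ ?_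
  have hfin : {t : K | (H (F + t • D)).det = 0}.Finite := by
    let Z : Matrix ι ι K := Matrix.of fun i k =>
      if p i ∧ ∃ j, ¬ p j ∧ φ i = φ j then P F i k else 0
    -- `D` adds `t` on the diagonal of the matched rows; scaling the identity rows by `t` does the
    -- same for the others. The determinant therefore divides the characteristic polynomial of `-Z`
    -- evaluated at `t`.
    have key : ∀ t : K, Matrix.diagonal (fun i => if p i ∧ ∃ j, ¬ p j ∧ φ i = φ j then 1 else t) *
        H (F + t • D) = Matrix.scalar ι t - (-Z) := by
      intro t
      ext i k
      rw [Matrix.diagonal_mul, sub_neg_eq_add, Matrix.add_apply, Matrix.scalar_apply]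
      by_cases hi : p i ∧ ∃ j, ¬ p j ∧ φ i = φ j
      · obtain ⟨hpi, j, hj, hij⟩ := hi
        have hi : p i ∧ ∃ j, ¬ p j ∧ φ i = φ j := ⟨hpi, j, hj, hij⟩
        have hsum : ∀ M : Matrix ι ι K, P M i k = if p k then M j k else 0 := by
          intro M
          simp only [P, Matrix.of_apply]
          rw [Finset.sum_eq_single j]
          · simp [hpi, hj, hij]
          · intro l _ hl
            rw [if_neg]
            rintro ⟨-, -, hpl, hkl⟩
            exact hl (h.inj _ _ (by simp [hpl, hj]) (hkl.symm.trans hij))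
          · simp
        simp only [H, Z, Matrix.of_apply, if_pos hi, one_mul, hsum]
        by_cases hk : p k
        · have hD : D j k = if i = k then 1 else 0 := by
            simp only [D, Matrix.of_apply, hk, hj, not_false_eq_true, true_and]
            refine if_congr ⟨fun h1 => h.inj _ _ (by simp [hpi, hk]) (hij.trans h1.symm), ?_⟩ rfl
              rfl
            rintro rfl
            exact hij
          simp only [if_pos hk, Matrix.add_apply, Matrix.smul_apply, hD, Matrix.diagonal_apply]
          split_ifs <;> simp [add_comm]
        · have hik : i ≠ k := by
            rintro rfl
            exact hk hpi
          simp [hk, hik]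
      · simp only [H, Z, Matrix.of_apply, if_neg hi, add_zero, Matrix.one_apply,
          Matrix.diagonal_apply]
        split_ifs <;> simp
    refine (Polynomial.finite_setOfPred_isRoot (Matrix.charpoly_monic (-Z)).ne_zero).subset ?_
    intro t ht
    rw [Set.mem_ofPred_eq] at ht ⊢
    rw [Polynomial.IsRoot.def, Matrix.eval_charpoly, ← key, Matrix.det_mul, ht, mul_zero]
  refine hfin.infinite_compl.mono fun t ht => ?_
  exact hunit _ (isUnit_iff_ne_zero.2 ht)

theorem relIndex_eq [Infinite K] (h : IsReduction r s p φ) : relIndex K r = relIndex K s :=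
  le_antisymm h.relIndex_le h.relIndex_ge

end IsReduction

end

/-! ### Seaweed algebras in `gl n` and their two reductions. -/

/-- Two natural numbers lie in the same block of a sequence of block sizes. -/
def sameBlock : List ℕ → ℕ → ℕ → Prop
  | [], _, _ => False
  | k :: a, i, j => (i < k ∧ j < k) ∨ (k ≤ i ∧ k ≤ j ∧ sameBlock a (i - k) (j - k))

theorem sameBlock_cons (k : ℕ) (a : List ℕ) (i j : ℕ) : sameBlock (k :: a) i j ↔
    (i < k ∧ j < k) ∨ (k ≤ i ∧ k ≤ j ∧ sameBlock a (i - k) (j - k)) := Iff.rfl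

theorem sameBlock_zero_cons (a : List ℕ) : sameBlock (0 :: a) = sameBlock a := by
  ext i j
  simp [sameBlock_cons]

theorem sameBlock.symm {a : List ℕ} {i j : ℕ} (h : sameBlock a i j) : sameBlock a j i := by
  induction a generalizing i j with
  | nil => exact h
  | cons k a ih =>
    rw [sameBlock_cons] at h ⊢
    rcases h with h | ⟨h1, h2, h3⟩
    · exact Or.inl ⟨h.2, h.1⟩
    · exact Or.inr ⟨h2, h1, ih h3⟩

theorem sameBlock.trans {a : List ℕ} {i j l : ℕ} (h : sameBlock a i j) (h' : sameBlock a j l) :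
    sameBlock a i l := by
  induction a generalizing i j l with
  | nil => exact h
  | cons k a ih =>
    rw [sameBlock_cons] at h h' ⊢
    rcases h with h | ⟨h1, h2, h3⟩ <;> rcases h' with h' | ⟨h1', h2', h3'⟩
    · exact Or.inl ⟨h.1, h'.2⟩
    · omega
    · omega
    · exact Or.inr ⟨h1, h2', ih h3 h3'⟩

theorem sameBlock.left {a : List ℕ} {i j l : ℕ} (h : sameBlock a i l) (hij : i ≤ j)
    (hjl : j ≤ l) : sameBlock a i j := by
  induction a generalizing i j l with
  | nil => exact h
  | cons k a ih =>
    rw [sameBlock_cons] at h ⊢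
    rcases h with h | ⟨h1, h2, h3⟩
    · left
      omega
    · exact Or.inr ⟨h1, by omega, ih h3 (by omega) (by omega)⟩

theorem sameBlock.right {a : List ℕ} {i j l : ℕ} (h : sameBlock a i l) (hij : i ≤ j)
    (hjl : j ≤ l) : sameBlock a j l := (h.left hij hjl).symm.trans h

/-- The positions at which the matrices of the seaweed algebra of type `a | b` may be non-zero. -/
def seaweedRel (a b : List ℕ) (n : ℕ) (i j : Fin n) : Prop :=
  i = j ∨ ((i : ℕ) < j ∧ sameBlock b i j) ∨ ((j : ℕ) < i ∧ sameBlock a i j)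

theorem seaweedRel_trans (a b : List ℕ) (n : ℕ) (i j k : Fin n) (hij : seaweedRel a b n i j)
    (hjk : seaweedRel a b n j k) : seaweedRel a b n i k := by
  rcases hij with rfl | ⟨h1, h2⟩ | ⟨h1, h2⟩
  · exact hjk
  · rcases hjk with rfl | ⟨h3, h4⟩ | ⟨h3, h4⟩
    · exact Or.inr (Or.inl ⟨h1, h2⟩)
    · exact Or.inr (Or.inl ⟨h1.trans h3, h2.trans h4⟩)
    · rcases lt_trichotomy (i : ℕ) k with h | h | h
      · exact Or.inr (Or.inl ⟨h, h2.left h.le h3.le⟩)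
      · exact Or.inl (Fin.ext h)
      · exact Or.inr (Or.inr ⟨h, (h4.symm.left h.le h1.le).symm⟩)
  · rcases hjk with rfl | ⟨h3, h4⟩ | ⟨h3, h4⟩
    · exact Or.inr (Or.inr ⟨h1, h2⟩)
    · rcases lt_trichotomy (i : ℕ) k with h | h | h
      · exact Or.inr (Or.inl ⟨h, h4.right h1.le h.le⟩)
      · exact Or.inl (Fin.ext h)
      · exact Or.inr (Or.inr ⟨h, (h2.symm.right h3.le h.le).symm⟩)
    · exact Or.inr (Or.inr ⟨h3.trans h1, h2.trans h4⟩)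

/-- The index of the seaweed algebra of type `a | b` in `gl n`. -/
noncomputable def listIndex (K : Type*) [Field K] (a b : List ℕ) (n : ℕ) : ℕ :=
  relIndex K (seaweedRel a b n)

theorem listIndex_comm (K : Type*) [Field K] (a b : List ℕ) (n : ℕ) :
    listIndex K a b n = listIndex K b a n := by
  rw [listIndex, ← relIndex_flip]
  congr 1
  ext i j
  simp only [seaweedRel]
  constructor
  · rintro (h | ⟨h1, h2⟩ | ⟨h1, h2⟩)
    · exact Or.inl h.symm
    · exact Or.inr (Or.inr ⟨h1, h2.symm⟩)
    · exact Or.inr (Or.inl ⟨h1, h2.symm⟩)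
  · rintro (h | ⟨h1, h2⟩ | ⟨h1, h2⟩)
    · exact Or.inl h.symm
    · exact Or.inr (Or.inr ⟨h1, h2.symm⟩)
    · exact Or.inr (Or.inl ⟨h1, h2.symm⟩)

theorem listIndex_zero_cons_left (K : Type*) [Field K] (a b : List ℕ) (n : ℕ) :
    listIndex K (0 :: a) b n = listIndex K a b n := by
  unfold listIndex seaweedRel
  rw [sameBlock_zero_cons]

/-- The ideal occupies rows `[0, k)` and columns `[k, k+e+k)`. The first `k` indices are partners of
the last `k` of the big block; all of `p` is matched, and removing it leaves the remaining `e + k`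
indices of that block cut into `e` and `k`. -/
theorem isReduction_short (a b : List ℕ) (k e n : ℕ) (hn : e + k ≤ n) :
    IsReduction (seaweedRel (k :: a) ((k + e + k) :: b) (n + k)) (seaweedRel a (e :: k :: b) n)
      (fun i => (i : ℕ) < k)
      (fun i => if h : (i : ℕ) < k then ⟨i + e, by omega⟩ else ⟨i - k, by omega⟩) where
  refl i := Or.inl rfl
  trans := seaweedRel_trans _ _ _
  trans' := seaweedRel_trans _ _ _
  full i j hi hj := by
    simp only [seaweedRel, sameBlock_cons, Fin.ext_iff]
    omega
  noBack i j hi hj := by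
    simp only [seaweedRel, sameBlock_cons, Fin.ext_iff]
    omega
  inj i j hij h := by
    simp only [Fin.ext_iff] at h ⊢
    split_ifs at h <;> simp only at h <;> omega
  lift i j hij h := by
    simp only [seaweedRel, sameBlock_cons, Fin.ext_iff] at h ⊢
    by_cases hi : (i : ℕ) < k
    · have hj := hij.1 hi
      simp only [hi, hj, dif_pos] at h
      omega
    · have hj : ¬ (j : ℕ) < k := fun hj => hi (hij.2 hj)
      simp only [hi, hj, dif_neg, not_false_eq_true, Nat.sub_sub] at h
      grind
  rep u v _ := by
    refine ⟨⟨u + k, by omega⟩, ⟨v + k, by omega⟩, ?_, ?_, ?_⟩ <;> simp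
  closed i l v hil h1 h2 := by
    by_cases hi : (i : ℕ) < k
    · have hl := hil.1 hi
      simp only [seaweedRel, sameBlock_cons, Fin.ext_iff, hi, hl, dif_pos] at h1 h2
      refine ⟨⟨v - e, by omega⟩, ?_, ?_⟩
      · simp only
        omega
      · simp only [Fin.ext_iff]
        rw [dif_pos (by omega)]
        simp only
        omega
    · exact ⟨⟨v + k, by omega⟩, by simp [hi], by simp⟩
  matched i j hi hj h := by
    simp only [hi, hj, dif_pos, dif_neg, not_false_eq_true, Fin.ext_iff] at h
    simp only [seaweedRel, sameBlock_cons, Fin.ext_iff]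
    omega
  outer i j hi hj h := by
    simp only [seaweedRel, sameBlock_cons, Fin.ext_iff] at h ⊢
    simp only [hi, hj, dif_neg, not_false_eq_true, Nat.sub_sub]
    by_cases hij : (i : ℕ) < k + e ∧ k + e ≤ j ∧ (j : ℕ) < k + e + k
    · right
      refine ⟨⟨⟨j - k - e, by omega⟩, ?_, ?_, ?_⟩, ?_⟩
      · simp only
        omega
      · simp only
        omega
      · rw [dif_pos (by simp only; omega)]
        simp only
        omega
      · intro l hl
        rw [dif_pos hl]
        simp only [ne_eq, Fin.ext_iff]
        omega
    · left
      rcases h with h | ⟨h1, h2 | ⟨h2, h3, h4⟩⟩ | ⟨h1, h2 | ⟨h2, h3, h4⟩⟩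
      · omega
      · omega
      · exact Or.inr (Or.inl ⟨by omega, Or.inr ⟨by omega, by omega,
          Or.inr ⟨by omega, by omega, h4⟩⟩⟩)
      · omega
      · exact Or.inr (Or.inr ⟨by omega, h4⟩)
  inner i l hi hl := by
    simp only [seaweedRel, sameBlock_cons, Fin.ext_iff, hi, hl, dif_pos]
    right
    refine ⟨⟨l + e + k, by omega⟩, ?_, ?_, ?_⟩
    · simp
    · simp only
      omega
    · simp
  cross i j hi hj h h' := by
    simp only [seaweedRel, sameBlock_cons, Fin.ext_iff, hi, hj, dif_pos, dif_neg,
      not_false_eq_true] at h h' ⊢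
    constructor
    · refine ⟨⟨j - k - e, by omega⟩, ?_, ?_⟩
      · simp only
        omega
      · rw [dif_pos (by simp only; omega)]
        simp only
        omega
    · exact ⟨⟨i + e + k, by omega⟩, by simp, by simp⟩
  unmatched i j hi hj h hno := by
    have hj' : (j : ℕ) < k + e := by
      by_contra hj'
      simp only [seaweedRel, sameBlock_cons, Fin.ext_iff] at h
      apply hno ⟨j - k - e, by omega⟩
      · simp only
        omega
      · rw [dif_pos (by simp only; omega), dif_neg hj]
        simp only [Fin.ext_iff]
        omega
    refine ⟨⟨i + e + k, by omega⟩, by simp, by simp [hi], ?_⟩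
    simp only [seaweedRel, sameBlock_cons, Fin.ext_iff]
    omega

/-- The ideal occupies rows `[0, e+m)` and columns `[e+m, e+m+m)`. Its `m` columns are all matched,
with the rows `[e, e+m)`; the rows below `e` stay unmatched and become the new first part on the
left. -/
theorem isReduction_long (a b : List ℕ) (e m n : ℕ) (hn : e + m ≤ n) :
    IsReduction (seaweedRel ((e + m) :: a) ((e + m + m) :: b) (n + m))
      (seaweedRel (e :: a) ((e + m) :: b) n) (fun i => (i : ℕ) < e + m)
      (fun i => if h : (i : ℕ) < e + m then ⟨i, by omega⟩ else ⟨i - m, by omega⟩) where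
  refl i := Or.inl rfl
  trans := seaweedRel_trans _ _ _
  trans' := seaweedRel_trans _ _ _
  full i j hi hj := by
    simp only [seaweedRel, sameBlock_cons, Fin.ext_iff]
    omega
  noBack i j hi hj := by
    simp only [seaweedRel, sameBlock_cons, Fin.ext_iff]
    omega
  inj i j hij h := by
    simp only [Fin.ext_iff] at h ⊢
    split_ifs at h <;> simp only at h <;> omega
  lift i j hij h := by
    simp only [seaweedRel, sameBlock_cons, Fin.ext_iff] at h ⊢
    by_cases hi : (i : ℕ) < e + m
    · have hj := hij.1 hi
      simp only [hi, hj, dif_pos] at h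
      omega
    · have hj : ¬ (j : ℕ) < e + m := fun hj => hi (hij.2 hj)
      simp only [hi, hj, dif_neg, not_false_eq_true, Nat.sub_sub,
        Nat.add_comm m] at h
      rcases h with h | ⟨h1, h2 | ⟨h2, h3, h4⟩⟩ | ⟨h1, h2 | ⟨h2, h3, h4⟩⟩
      · omega
      · omega
      · exact Or.inr (Or.inl ⟨by omega, Or.inr ⟨by omega, by omega, h4⟩⟩)
      · omega
      · exact Or.inr (Or.inr ⟨by omega, Or.inr ⟨by omega, by omega, h4⟩⟩)
  rep u v h := by
    simp only [seaweedRel, sameBlock_cons, Fin.ext_iff] at h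
    by_cases huv : (u : ℕ) < e + m ∧ (v : ℕ) < e + m
    · refine ⟨⟨u, by omega⟩, ⟨v, by omega⟩, ?_, ?_, ?_⟩ <;> simp [huv]
    · refine ⟨⟨u + m, by omega⟩, ⟨v + m, by omega⟩, ?_, ?_, ?_⟩
      · simp only
        omega
      · rw [dif_neg (by simp only; omega)]
        simp
      · rw [dif_neg (by simp only; omega)]
        simp
  closed i l v hil h1 h2 := by
    by_cases hi : (i : ℕ) < e + m
    · have hl := hil.1 hi
      simp only [seaweedRel, sameBlock_cons, Fin.ext_iff, hi, hl, dif_pos] at h1 h2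
      have hv : (v : ℕ) < e + m := by omega
      exact ⟨⟨v, by omega⟩, by simp [hi, hv], by simp [hv]⟩
    · have hl : ¬ (l : ℕ) < e + m := fun hl => hi (hil.2 hl)
      simp only [seaweedRel, sameBlock_cons, Fin.ext_iff, hi, hl, dif_neg,
        not_false_eq_true] at h1 h2
      have hv : e ≤ (v : ℕ) := by omega
      refine ⟨⟨v + m, by omega⟩, by simp [hi, hv], ?_⟩
      rw [dif_neg (by simp only; omega)]
      simp
  matched i j hi hj h := by
    simp only [hi, hj, dif_pos, dif_neg, not_false_eq_true, Fin.ext_iff] at h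
    simp only [seaweedRel, sameBlock_cons, Fin.ext_iff]
    omega
  outer i j hi hj h := by
    simp only [seaweedRel, sameBlock_cons, Fin.ext_iff] at h ⊢
    simp only [hi, hj, dif_neg, not_false_eq_true, Nat.sub_sub, Nat.add_comm m]
    left
    rcases h with h | ⟨h1, h2 | ⟨h2, h3, h4⟩⟩ | ⟨h1, h2 | ⟨h2, h3, h4⟩⟩
    · omega
    · omega
    · exact Or.inr (Or.inl ⟨by omega, Or.inr ⟨by omega, by omega, h4⟩⟩)
    · omega
    · exact Or.inr (Or.inr ⟨by omega, Or.inr ⟨by omega, by omega, h4⟩⟩)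
  inner i l hi hl := by
    simp only [seaweedRel, sameBlock_cons, Fin.ext_iff, hi, hl, dif_pos]
    by_cases hl' : (l : ℕ) < e
    · left
      rcases lt_trichotomy (l : ℕ) i with h | h | h
      · exact Or.inr (Or.inl ⟨h, Or.inl ⟨trivial, trivial⟩⟩)
      · exact Or.inl h
      · exact Or.inr (Or.inr ⟨h, Or.inl ⟨hl', h.trans hl'⟩⟩)
    · right
      refine ⟨⟨l + m, by omega⟩, ?_, ?_, ?_⟩
      · simp only
        omega
      · simp only
        omega
      · rw [dif_neg (by simp only; omega)]
        simp
  cross i j hi hj h h' := by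
    simp only [seaweedRel, sameBlock_cons, Fin.ext_iff, hi, hj, dif_pos, dif_neg,
      not_false_eq_true] at h h' ⊢
    constructor
    · refine ⟨⟨j - m, by omega⟩, ?_, ?_⟩
      · simp only
        omega
      · rw [dif_pos (by simp only; omega)]
    · refine ⟨⟨i + m, by omega⟩, ?_, ?_⟩
      · simp only
        omega
      · rw [dif_neg (by simp only; omega)]
        simp
  unmatched i j hi hj h hno := by
    exfalso
    simp only [seaweedRel, sameBlock_cons, Fin.ext_iff] at h
    apply hno ⟨j - m, by omega⟩
    · simp only
      omega
    · rw [dif_pos (by simp only; omega), dif_neg hj]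

theorem listIndex_short (K : Type*) [Field K] [Infinite K] (a b : List ℕ) (k e n : ℕ)
    (hn : e + k ≤ n) :
    listIndex K (k :: a) ((k + e + k) :: b) (n + k) = listIndex K a (e :: k :: b) n :=
  (isReduction_short a b k e n hn).relIndex_eq

theorem listIndex_long (K : Type*) [Field K] [Infinite K] (a b : List ℕ) (e m n : ℕ)
    (hn : e + m ≤ n) :
    listIndex K ((e + m) :: a) ((e + m + m) :: b) (n + m) =
      listIndex K (e :: a) ((e + m) :: b) n :=
  (isReduction_long a b e m n hn).relIndex_eq

/-! ### The index of `gl n` and the splitting of a common first part. -/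

section
variable {K : Type*} [Field K]

theorem mem_relKer_full {ι : Type*} [Fintype ι] {F x : Matrix ι ι K} :
    x ∈ relKer (fun _ _ => True) F ↔ F * x = x * F := by
  rw [mem_relKer_iff]
  constructor
  · rintro ⟨-, h⟩
    rw [← sub_eq_zero]
    ext j i
    exact h i j trivial
  · intro h
    refine ⟨fun i j hij => absurd trivial hij, fun i j _ => ?_⟩
    rw [h, sub_self]
    rfl

/-- If the Krylov vectors `X ^ j v` are independent, then the centralizer of `X` has dimension
at least `n`. -/
theorem le_finrank_relKer_full {n : ℕ} (X : Matrix (Fin n) (Fin n) K) (v : Fin n → K)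
    (h : (Matrix.of fun i j : Fin n => ((X ^ (j : ℕ)).mulVec v) i).det ≠ 0) :
    n ≤ Module.finrank K (relKer (fun _ _ => True) X) := by
  have hli : LinearIndependent K fun j : Fin n => X ^ (j : ℕ) := by
    have h1 : LinearIndependent K fun j : Fin n => (X ^ (j : ℕ)).mulVec v := by
      have h2 := Matrix.linearIndependent_cols_of_det_ne_zero h
      exact h2
    refine LinearIndependent.of_comp
      ((LinearMap.applyₗ v) ∘ₗ (Matrix.toLin' : Matrix (Fin n) (Fin n) K ≃ₗ[K] _).toLinearMap) ?_
    convert h1 using 1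
    ext j i
    simp [Matrix.toLin'_apply, -Matrix.toLin'_pow, -map_pow]
  have hmem : ∀ j : Fin n, X ^ (j : ℕ) ∈ relKer (fun _ _ => True) X := fun j =>
    mem_relKer_full.2 (Commute.self_pow X j)
  have h3 : LinearIndependent K fun j : Fin n =>
      (⟨X ^ (j : ℕ), hmem j⟩ : relKer (fun _ _ => True) X) :=
    LinearIndependent.of_comp (relKer (fun _ _ => True) X).subtype hli
  simpa using h3.fintype_card_le_finrank

/-- A diagonal matrix with distinct entries has the diagonal matrices as centralizer, which bounds
the index above. A matrix with a cyclic vector has `n` independent powers in its centralizer; since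
`D` has such a vector, so has almost every matrix of the pencil, and semicontinuity gives the lower
bound. -/
theorem relIndex_full [CharZero K] (n : ℕ) :
    relIndex K (fun _ _ : Fin n => True) = n := by
  let D : Matrix (Fin n) (Fin n) K := Matrix.diagonal fun i => ((i : ℕ) : K)
  have hD : ∀ i j : Fin n, ((i : ℕ) : K) = ((j : ℕ) : K) → i = j := by
    intro i j hij
    exact Fin.ext (Nat.cast_injective hij)
  apply le_antisymm
  · refine (relIndex_le _ D).trans ?_
    have hle : relKer (fun _ _ => True) D ≤
        LinearMap.range (Matrix.diagonalLinearMap (Fin n) K K) := by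
      intro x hx
      rw [mem_relKer_full] at hx
      refine ⟨x.diag, ?_⟩
      ext i j
      by_cases hij : i = j
      · subst hij
        simp
      · have h1 := congrFun (congrFun hx i) j
        rw [Matrix.diagonal_mul, Matrix.mul_diagonal, mul_comm, ← sub_eq_zero, ← mul_sub] at h1
        have h2 := (mul_eq_zero.1 h1).resolve_right fun h3 => hij (hD _ _ (sub_eq_zero.1 h3))
        simp [Matrix.diagonal_apply_ne _ hij, h2]
    refine (Submodule.finrank_mono hle).trans ((LinearMap.finrank_range_le _).trans ?_)
    simp
  · obtain ⟨F, hF⟩ := exists_relIndex_eq (K := K) (fun _ _ : Fin n => True)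
    rw [← hF]
    refine le_finrank_relKer_of_infinite _ F D n ?_
    -- the determinant of the Krylov vectors of `D + s F` as a polynomial in `s`
    let Y : Matrix (Fin n) (Fin n) (Polynomial K) :=
      D.map Polynomial.C + (Polynomial.X : Polynomial K) • F.map Polynomial.C
    let Q : Polynomial K :=
      (Matrix.of fun i j : Fin n => ((Y ^ (j : ℕ)).mulVec fun _ => 1) i).det
    have hQ : ∀ s : K, Q.eval s =
        (Matrix.of fun i j : Fin n => (((D + s • F) ^ (j : ℕ)).mulVec fun _ => 1) i).det := by
      intro s
      have hY : (Polynomial.evalRingHom s).mapMatrix Y = D + s • F := by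
        ext i j
        simp [Y, mul_comm (F i j)]
      rw [← Polynomial.coe_evalRingHom, RingHom.map_det]
      congr 1
      ext i j
      rw [← hY, Matrix.of_apply, ← map_pow]
      simp [Matrix.mulVec, dotProduct, Polynomial.eval_finsetSum]
    have hQ0 : Q ≠ 0 := by
      intro h0
      have h1 := hQ 0
      rw [h0, Polynomial.eval_zero, zero_smul, add_zero] at h1
      have h2 : (Matrix.of fun i j : Fin n => ((D ^ (j : ℕ)).mulVec fun _ => 1) i) =
          Matrix.vandermonde fun i : Fin n => ((i : ℕ) : K) := by
        ext i j
        simp [D, Matrix.diagonal_pow, Matrix.mulVec_diagonal]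
      rw [h2, eq_comm, Matrix.det_vandermonde_eq_zero_iff] at h1
      obtain ⟨i, j, hij, hne⟩ := h1
      exact hne (hD _ _ hij)
    have hfin : {t : K | t = 0 ∨ Q.eval t⁻¹ = 0}.Finite := by
      refine ((Set.finite_singleton (0 : K)).union
        ((Polynomial.finite_setOfPred_isRoot hQ0).preimage (f := fun t : K => t⁻¹)
          fun a _ b _ hab => inv_injective hab)).subset ?_
      rintro t (ht | ht)
      · exact Or.inl ht
      · exact Or.inr ht
    refine hfin.infinite_compl.mono fun t ht => ?_
    simp only [Set.mem_compl_iff, Set.mem_ofPred_eq, not_or] at ht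
    rw [Set.mem_ofPred_eq]
    have h1 := le_finrank_relKer_full (D + t⁻¹ • F) (fun _ => 1) (by rw [← hQ]; exact ht.2)
    -- Nonzero scaling does not change the centralizer, so the pencil may be studied near `D`, where
    -- the Krylov determinant is a Vandermonde.
    have h2 : relKer (fun _ _ => True) (F + t • D) =
        relKer (fun _ _ => True) (D + t⁻¹ • F) := by
      ext x
      have h3 : F + t • D = t • (D + t⁻¹ • F) := by
        rw [smul_add, smul_smul, mul_inv_cancel₀ ht.1, one_smul, add_comm]
      rw [mem_relKer_full, mem_relKer_full, h3, Matrix.smul_mul, Matrix.mul_smul]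
      exact (smul_right_injective _ ht.1).eq_iff
    rw [h2]
    exact h1

/-- The index is additive for disjoint unions of relations. -/
theorem relIndex_sum {α β : Type*} [Fintype α] [Fintype β] (r : α ⊕ β → α ⊕ β → Prop)
    (h₁ : ∀ i j, ¬ r (Sum.inl i) (Sum.inr j)) (h₂ : ∀ i j, ¬ r (Sum.inr i) (Sum.inl j)) :
    relIndex K r = relIndex K (fun i j => r (Sum.inl i) (Sum.inl j)) +
      relIndex K (fun i j => r (Sum.inr i) (Sum.inr j)) := by
  have key : ∀ F : Matrix (α ⊕ β) (α ⊕ β) K, Module.finrank K (relKer r F) =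
      Module.finrank K (relKer (fun i j => r (Sum.inl i) (Sum.inl j)) F.toBlocks₁₁) +
      Module.finrank K (relKer (fun i j => r (Sum.inr i) (Sum.inr j)) F.toBlocks₂₂) := by
    intro F
    have e : relKer r F ≃ₗ[K] (relKer (fun i j => r (Sum.inl i) (Sum.inl j)) F.toBlocks₁₁) ×
        (relKer (fun i j => r (Sum.inr i) (Sum.inr j)) F.toBlocks₂₂) := by
      have hblock : ∀ x ∈ suppSub K r, x = Matrix.fromBlocks x.toBlocks₁₁ 0 0 x.toBlocks₂₂ := by
        intro x hx
        have h3 : x.toBlocks₁₂ = 0 := by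
          ext i j
          exact hx _ _ (h₁ i j)
        have h4 : x.toBlocks₂₁ = 0 := by
          ext i j
          exact hx _ _ (h₂ i j)
        rw [← h3, ← h4, Matrix.fromBlocks_toBlocks]
      have hmem : ∀ x y, Matrix.fromBlocks x 0 0 y ∈ relKer r F ↔
          x ∈ relKer (fun i j => r (Sum.inl i) (Sum.inl j)) F.toBlocks₁₁ ∧
          y ∈ relKer (fun i j => r (Sum.inr i) (Sum.inr j)) F.toBlocks₂₂ := by
        intro x y
        simp only [mem_relKer_iff]
        have hF := Matrix.fromBlocks_toBlocks F
        rw [← hF]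
        simp only [Matrix.fromBlocks_multiply, Matrix.toBlocks_fromBlocks₁₁,
          Matrix.toBlocks_fromBlocks₂₂, mem_suppSub]
        constructor
        · rintro ⟨h3, h4⟩
          refine ⟨⟨fun i j hij => h3 _ _ hij, fun i j hij => ?_⟩,
            ⟨fun i j hij => h3 _ _ hij, fun i j hij => ?_⟩⟩
          · simpa using h4 _ _ hij
          · simpa using h4 _ _ hij
        · rintro ⟨⟨h3, h4⟩, ⟨h5, h6⟩⟩
          constructor
          · rintro (i | i) (j | j) hij
            · exact h3 _ _ hij
            · rfl
            · rfl
            · exact h5 _ _ hij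
          · rintro (i | i) (j | j) hij
            · simpa using h4 _ _ hij
            · exact absurd hij (h₁ _ _)
            · exact absurd hij (h₂ _ _)
            · simpa using h6 _ _ hij
      exact
        { toFun := fun x => (⟨x.1.toBlocks₁₁, ((hmem _ _).1 (hblock x.1 x.2.1 ▸ x.2)).1⟩,
            ⟨x.1.toBlocks₂₂, ((hmem _ _).1 (hblock x.1 x.2.1 ▸ x.2)).2⟩)
          invFun := fun y => ⟨Matrix.fromBlocks y.1 0 0 y.2, (hmem _ _).2 ⟨y.1.2, y.2.2⟩⟩
          map_add' := fun x y => rfl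
          map_smul' := fun c x => rfl
          left_inv := fun x => Subtype.ext (hblock x.1 x.2.1).symm
          right_inv := fun y => rfl }
    rw [e.finrank_eq, Module.finrank_prod]
  apply le_antisymm
  · obtain ⟨F, hF⟩ := exists_relIndex_eq (K := K) fun i j => r (Sum.inl i) (Sum.inl j)
    obtain ⟨G, hG⟩ := exists_relIndex_eq (K := K) fun i j => r (Sum.inr i) (Sum.inr j)
    rw [← hF, ← hG]
    refine (relIndex_le r (Matrix.fromBlocks F 0 0 G)).trans ?_
    rw [key, Matrix.toBlocks_fromBlocks₁₁, Matrix.toBlocks_fromBlocks₂₂]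
  · obtain ⟨F, hF⟩ := exists_relIndex_eq (K := K) r
    rw [← hF, key]
    exact add_le_add (relIndex_le _ _) (relIndex_le _ _)

/-- No position joins the first `k` indices to the others, and all positions among them are allowed,
so a factor `gl k` splits off. -/
theorem listIndex_cons_cons [CharZero K] (a b : List ℕ) (k n : ℕ) :
    listIndex K (k :: a) (k :: b) (k + n) = k + listIndex K a b n := by
  rw [listIndex, ← relIndex_congr_equiv finSumFinEquiv
    (fun i j => seaweedRel (k :: a) (k :: b) (k + n) (finSumFinEquiv i) (finSumFinEquiv j)) _
    fun _ _ => Iff.rfl, relIndex_sum]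
  · congr 1
    · refine (relIndex_congr_equiv (Equiv.refl _) _ _ fun i j => ?_).trans
        (relIndex_full (K := K) k)
      simp only [seaweedRel, sameBlock_cons, finSumFinEquiv_apply_left, Fin.ext_iff,
        Fin.val_castAdd, iff_true]
      omega
    · refine relIndex_congr_equiv (Equiv.refl _) _ _ fun i j => ?_
      simp only [seaweedRel, sameBlock_cons, finSumFinEquiv_apply_right, Fin.ext_iff,
        Fin.val_natAdd, Nat.add_sub_cancel_left]
      simp
  · intro i j
    simp only [seaweedRel, sameBlock_cons, finSumFinEquiv_apply_left, finSumFinEquiv_apply_right,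
      Fin.ext_iff, Fin.val_natAdd, Fin.val_castAdd]
    omega
  · intro i j
    simp only [seaweedRel, sameBlock_cons, finSumFinEquiv_apply_left, finSumFinEquiv_apply_right,
      Fin.ext_iff, Fin.val_natAdd, Fin.val_castAdd]
    omega

theorem listIndex_nil [CharZero K] (a b : List ℕ) : listIndex K a b 0 = 0 := by
  exact (relIndex_congr_equiv (Equiv.refl _) _ _ fun i => i.elim0).trans
    (relIndex_full (K := K) 0)

end

/-! ### From flag stabilizers in `sl n` to supported matrices in `gl n`. -/

/-- Partial sums are the block boundaries, and one of them separates `s < t` exactly when the blocks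
differ. This converts invariance of a flag into a condition on matrix positions. -/
theorem forall_lt_sum_take_iff (l : List ℕ) (s t : ℕ) (hs : s < l.sum) :
    (∀ i, s < (l.take i).sum → t < (l.take i).sum) ↔ t ≤ s ∨ sameBlock l t s := by
  induction l generalizing s t with
  | nil => simp at hs
  | cons k l ih =>
    rw [sameBlock_cons]
    have hcons : (∀ i, s < ((k :: l).take i).sum → t < ((k :: l).take i).sum) ↔
        ∀ i, s < k + (l.take i).sum → t < k + (l.take i).sum := by
      constructor
      · intro h i hi
        simpa using h (i + 1) (by simpa using hi)
      · rintro h (_ | i) hi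
        · simp at hi
        · simpa using h i (by simpa using hi)
    rw [hcons]
    rw [List.sum_cons] at hs
    by_cases hsk : s < k
    · by_cases htk : t < k
      · exact ⟨fun _ => Or.inr (Or.inl ⟨htk, hsk⟩), fun _ i _ => by omega⟩
      · constructor
        · intro h
          have := h 0 (by simpa using hsk)
          simp only [List.take_zero, List.sum_nil] at this
          omega
        · intro h
          omega
    · by_cases htk : t < k
      · exact ⟨fun _ => by omega, fun _ i _ => by omega⟩
      · have h1 := ih (s - k) (t - k) (by omega)
        have h2 : (∀ i, s < k + (l.take i).sum → t < k + (l.take i).sum) ↔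
            ∀ i, s - k < (l.take i).sum → t - k < (l.take i).sum :=
          forall_congr' fun i => by omega
        rw [h2, h1]
        constructor
        · rintro (h | h)
          · left
            omega
          · exact Or.inr (Or.inr ⟨by omega, by omega, h⟩)
        · rintro (h | h | ⟨-, -, h⟩)
          · left
            omega
          · omega
          · exact Or.inr h

theorem Composition.forall_lt_sizeUpTo_iff {n : ℕ} (a : Composition n) (s t : Fin n) :
    (∀ i : Fin (a.length + 1), (s : ℕ) < a.sizeUpTo i → (t : ℕ) < a.sizeUpTo i) ↔
      (t : ℕ) ≤ s ∨ sameBlock a.blocks t s := by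
  rw [← forall_lt_sum_take_iff a.blocks s t (by rw [a.blocks_sum]; exact s.2)]
  constructor
  · intro h i hi
    by_cases hil : i ≤ a.length
    · exact h ⟨i, by omega⟩ hi
    · rw [List.take_of_length_le (by rw [Composition.blocks_length]; omega), a.blocks_sum]
      exact t.2
  · exact fun h i => h i

section
variable {K : Type*} [Field K]

theorem mem_span_single_iff {n : ℕ} (P : Fin n → Prop) (v : Fin n → K) :
    v ∈ Submodule.span K {v : Fin n → K | ∃ s : Fin n, P s ∧ v = Pi.single s 1} ↔
      ∀ t, ¬ P t → v t = 0 := by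
  constructor
  · intro hv t ht
    induction hv using Submodule.span_induction with
    | mem x hx =>
      obtain ⟨s, hs, rfl⟩ := hx
      rw [Pi.single_eq_of_ne]
      rintro rfl
      exact ht hs
    | zero => rfl
    | add x y _ _ hx hy => rw [Pi.add_apply, hx, hy, add_zero]
    | smul c x _ hx => rw [Pi.smul_apply, hx, smul_zero]
  · intro h
    rw [pi_eq_sum_univ' v]
    refine Submodule.sum_mem _ fun s _ => ?_
    by_cases hs : P s
    · refine Submodule.smul_mem _ _ (Submodule.subset_span ⟨s, hs, ?_⟩)
      ext j
      simp [Pi.single_apply, eq_comm]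
    · rw [h s hs, zero_smul]
      exact Submodule.zero_mem _

theorem mulVec_mem_span_single_iff {n : ℕ} (P : Fin n → Prop) (A : Matrix (Fin n) (Fin n) K) :
    (∀ v ∈ Submodule.span K {v : Fin n → K | ∃ s : Fin n, P s ∧ v = Pi.single s 1},
      A.mulVec v ∈ Submodule.span K {v : Fin n → K | ∃ s : Fin n, P s ∧ v = Pi.single s 1}) ↔
      ∀ s t, P s → ¬ P t → A t s = 0 := by
  simp only [mem_span_single_iff]
  constructor
  · intro h s t hs ht
    have h1 := h (Pi.single s 1) (fun t ht => Pi.single_eq_of_ne (by rintro rfl; exact ht hs) _) t ht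
    simpa using h1
  · intro h v hv t ht
    rw [Matrix.mulVec, dotProduct]
    refine Finset.sum_eq_zero fun s _ => ?_
    by_cases hs : P s
    · rw [h s t hs ht, zero_mul]
    · rw [hv s hs, mul_zero]

theorem lieSubalgebra_mem_iInf {R L : Type*} [CommRing R] [LieRing L] [LieAlgebra R L]
    {ι : Sort*} (p : ι → LieSubalgebra R L) (x : L) : x ∈ ⨅ i, p i ↔ ∀ i, x ∈ p i := by
  rw [iInf, ← SetLike.mem_coe, LieSubalgebra.coe_sInf]
  simp

theorem mem_seaweed_iff {n : ℕ} (a b : Composition n)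
    (A : LieAlgebra.SpecialLinear.sl (Fin n) K) :
    A ∈ seaweed K a b ↔ (A : Matrix (Fin n) (Fin n) K) ∈
      suppSub K (seaweedRel a.blocks b.blocks n) := by
  have h1 : ∀ i : ℕ, A ∈ slStabilizer K (ascFlag K a i) ↔ ∀ s t : Fin n,
      (s : ℕ) < a.sizeUpTo i → ¬ (t : ℕ) < a.sizeUpTo i →
        (A : Matrix (Fin n) (Fin n) K) t s = 0 :=
    fun i => mulVec_mem_span_single_iff (fun s : Fin n => (s : ℕ) < a.sizeUpTo i) A.1
  have h2 : ∀ i : ℕ, A ∈ slStabilizer K (descFlag K b i) ↔ ∀ s t : Fin n,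
      b.sizeUpTo i ≤ (s : ℕ) → ¬ b.sizeUpTo i ≤ (t : ℕ) →
        (A : Matrix (Fin n) (Fin n) K) t s = 0 :=
    fun i => mulVec_mem_span_single_iff (fun s : Fin n => b.sizeUpTo i ≤ (s : ℕ)) A.1
  rw [seaweed, LieSubalgebra.mem_inf, lieSubalgebra_mem_iInf, lieSubalgebra_mem_iInf, mem_suppSub]
  simp only [h1, h2]
  constructor
  · rintro ⟨ha, hb⟩ t s hts
    by_contra hne
    apply hts
    have h3 := (a.forall_lt_sizeUpTo_iff s t).1 fun i hi => by
      by_contra hti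
      exact hne (ha i s t hi hti)
    have h4 := (b.forall_lt_sizeUpTo_iff t s).1 fun i hi => by
      by_contra hti
      exact hne (hb i s t (by omega) (by omega))
    rcases lt_trichotomy (t : ℕ) s with h | h | h
    · exact Or.inr (Or.inl ⟨h, (h4.resolve_left (by omega)).symm⟩)
    · exact Or.inl (Fin.ext h)
    · exact Or.inr (Or.inr ⟨h, h3.resolve_left (by omega)⟩)
  · intro h
    constructor
    · intro i s t hs ht
      apply h
      intro hrel
      refine ht ((a.forall_lt_sizeUpTo_iff s t).2 ?_ i hs)
      rcases hrel with rfl | ⟨h3, -⟩ | ⟨-, h3⟩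
      · exact Or.inl le_rfl
      · exact Or.inl h3.le
      · exact Or.inr h3
    · intro i s t hs ht
      apply h
      intro hrel
      refine absurd ((b.forall_lt_sizeUpTo_iff t s).2 ?_ i (by omega)) (by omega)
      rcases hrel with rfl | ⟨-, h3⟩ | ⟨h3, -⟩
      · exact Or.inl le_rfl
      · exact Or.inr h3.symm
      · exact Or.inl h3.le

/-- The inclusion of a seaweed algebra into the space of all matrices. -/
def seaweedIncl {n : ℕ} (a b : Composition n) : seaweed K a b →ₗ[K] Matrix (Fin n) (Fin n) K where
  toFun x := x.1.1
  map_add' _ _ := rfl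
  map_smul' _ _ := rfl

theorem exists_seaweedIncl_eq {n : ℕ} {a b : Composition n} {x : Matrix (Fin n) (Fin n) K}
    (hx : x ∈ suppSub K (seaweedRel a.blocks b.blocks n)) (htr : x.trace = 0) :
    ∃ y, seaweedIncl a b y = x := by
  have h1 : x ∈ LieAlgebra.SpecialLinear.sl (Fin n) K :=
    htr
  exact ⟨⟨⟨x, h1⟩, (mem_seaweed_iff a b ⟨x, h1⟩).2 hx⟩, rfl⟩

/-- The identity is always in the radical, and its trace `n` is nonzero in `K`. So the trace maps
the radical onto `K`, and the traceless radical elements form the kernel of the Kirillov form. -/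
theorem finrank_ker_kirillovForm_add_one [CharZero K] {n : ℕ} (hn : n ≠ 0) (a b : Composition n)
    (f : Module.Dual K (seaweed K a b)) (F : Matrix (Fin n) (Fin n) K)
    (hF : ∀ y, f y = Matrix.trace (F * seaweedIncl a b y)) :
    Module.finrank K (LinearMap.ker (kirillovForm f)) + 1 =
      Module.finrank K (relKer (seaweedRel a.blocks b.blocks n) F) := by
  set r := seaweedRel a.blocks b.blocks n with hr
  have h1mem : (1 : Matrix (Fin n) (Fin n) K) ∈ suppSub K r := fun i j hij =>
    Matrix.one_apply_ne fun h => hij (Or.inl h)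
  have h1rad : (1 : Matrix (Fin n) (Fin n) K) ∈ relKer r F := by
    refine ⟨h1mem, fun y _ => ?_⟩
    rw [traceComm_apply, one_mul, mul_one, sub_self, mul_zero, Matrix.trace_zero]
  have hn' : (n : K) ≠ 0 := Nat.cast_ne_zero.2 hn
  let T : relKer r F →ₗ[K] K := Matrix.traceLinearMap (Fin n) K K ∘ₗ (relKer r F).subtype
  have hT1 : T ⟨1, h1rad⟩ = n := by simp [T]
  have hrange : LinearMap.range T = ⊤ := by
    rw [LinearMap.range_eq_top]
    intro c
    refine ⟨(c / n) • ⟨1, h1rad⟩, ?_⟩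
    rw [map_smul, hT1, smul_eq_mul, div_mul_cancel₀ _ hn']
  have hdim := LinearMap.finrank_range_add_finrank_ker T
  rw [hrange, finrank_top, Module.finrank_self] at hdim
  have hker : Module.finrank K (LinearMap.ker T) =
      Module.finrank K (LinearMap.ker (kirillovForm f)) := by
    rw [← finrank_map_eq_of_injOn (relKer r F).subtype (LinearMap.ker T)
      fun x _ hx => Subtype.ext hx, ← finrank_map_eq_of_injOn (seaweedIncl a b)
      (LinearMap.ker (kirillovForm f)) fun x _ hx => Subtype.ext (Subtype.ext hx)]
    suffices h : (LinearMap.ker T).map (relKer r F).subtype =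
        (LinearMap.ker (kirillovForm f)).map (seaweedIncl a b) by rw [h]
    have hform : ∀ x y, f ⁅x, y⁆ = traceComm F (seaweedIncl a b x) (seaweedIncl a b y) := by
      intro x y
      rw [hF]
      rfl
    ext x
    constructor
    · rintro ⟨⟨x, hx⟩, hxT, rfl⟩
      obtain ⟨y, rfl⟩ := exists_seaweedIncl_eq (a := a) (b := b) hx.1 hxT
      refine ⟨y, LinearMap.ext fun z => ?_, rfl⟩
      rw [kirillovForm_apply, hform]
      exact hx.2 _ ((mem_seaweed_iff a b z.1).1 z.2)
    · rintro ⟨y, hy, rfl⟩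
      have htr : ∀ z : seaweed K a b, (seaweedIncl a b z).trace = 0 := fun z =>
        z.1.2
      refine ⟨⟨seaweedIncl a b y, (mem_seaweed_iff a b y.1).1 y.2, fun z hz => ?_⟩, htr y, rfl⟩
      -- A supported matrix is made traceless by subtracting a scalar, which pairs to zero with
      -- everything.
      obtain ⟨z', hz'⟩ := exists_seaweedIncl_eq (a := a) (b := b)
        (x := z - (z.trace / n) • 1)
        (Submodule.sub_mem _ hz (Submodule.smul_mem _ _ h1mem)) (by
          rw [Matrix.trace_sub, Matrix.trace_smul, Matrix.trace_one, Fintype.card_fin,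
            smul_eq_mul, div_mul_cancel₀ _ hn', sub_self])
      have h2 : z = seaweedIncl a b z' + (z.trace / n) • 1 := by rw [hz', sub_add_cancel]
      have h3 : traceComm F (seaweedIncl a b y) 1 = 0 := by
        rw [traceComm_apply, one_mul, mul_one, sub_self, mul_zero, Matrix.trace_zero]
      rw [h2, map_add, map_smul, h3, smul_zero, add_zero, ← hform]
      exact LinearMap.congr_fun hy z'
  omega

theorem lieIndex_seaweed_add_one [CharZero K] {n : ℕ} (hn : n ≠ 0) (a b : Composition n) :
    lieIndex K (seaweed K a b) + 1 = listIndex K a.blocks b.blocks n := by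
  apply le_antisymm
  · obtain ⟨F, hF⟩ := exists_relIndex_eq (K := K) (seaweedRel a.blocks b.blocks n)
    rw [listIndex, ← hF, ← finrank_ker_kirillovForm_add_one hn a b
      (Matrix.traceLinearMap (Fin n) K K ∘ₗ LinearMap.mulLeft K F ∘ₗ seaweedIncl a b) F
      fun _ => rfl]
    exact Nat.succ_le_succ (Nat.sInf_le ⟨_, rfl⟩)
  · obtain ⟨f, hf⟩ := Nat.sInf_mem (Set.range_nonempty fun f : Module.Dual K (seaweed K a b) =>
      Module.finrank K (LinearMap.ker (kirillovForm f)))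
    have hinj : LinearMap.ker (seaweedIncl (K := K) a b) = ⊥ :=
      LinearMap.ker_eq_bot'.2 fun x hx => Subtype.ext (Subtype.ext hx)
    obtain ⟨G, hG⟩ := LinearMap.exists_leftInverse_of_injective _ hinj
    obtain ⟨F, hF⟩ := exists_trace_mul_eq (f ∘ₗ G)
    have h1 := finrank_ker_kirillovForm_add_one hn a b f F fun y => by
      rw [← hF, LinearMap.comp_apply, show G (seaweedIncl a b y) = y from LinearMap.congr_fun hG y]
    simp only at hf
    rw [lieIndex, ← hf, h1]
    exact relIndex_le _ _

end

/-! ### The recursion for the defect and the pairs of defect at most two. -/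

/-- Prepend a part to a sequence, unless it is zero. -/
def consPos (k : ℕ) (l : List ℕ) : List ℕ := if k = 0 then l else k :: l

theorem consPos_zero (l : List ℕ) : consPos 0 l = l := rfl

theorem consPos_of_pos {k : ℕ} (hk : 0 < k) (l : List ℕ) : consPos k l = k :: l :=
  if_neg hk.ne'

theorem consPos_sum (k : ℕ) (l : List ℕ) : (consPos k l).sum = k + l.sum := by
  rcases Nat.eq_zero_or_pos k with rfl | hk
  · simp [consPos_zero]
  · rw [consPos_of_pos hk, List.sum_cons]

theorem pos_of_mem_consPos {k : ℕ} {l : List ℕ} (h : ∀ x ∈ l, 0 < x) :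
    ∀ x ∈ consPos k l, 0 < x := by
  rcases Nat.eq_zero_or_pos k with rfl | hk
  · exact h
  · rw [consPos_of_pos hk]
    simpa [hk] using h

/-- The recursion satisfied by the defect `n - ind` of the seaweed algebras in `gl n`. -/
structure IsDefect (δ : List ℕ → List ℕ → ℕ) : Prop where
  nil : δ [] [] = 0
  comm : ∀ a b, a.sum = b.sum → δ a b = δ b a
  cons_cons : ∀ k a b, a.sum = b.sum → δ (k :: a) (k :: b) = δ a b
  short : ∀ k e a b, a.sum = e + k + b.sum →
    δ (k :: a) ((k + e + k) :: b) = k + δ a (consPos e (k :: b))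
  long : ∀ e m a b, a.sum = m + b.sum →
    δ ((e + m) :: a) ((e + m + m) :: b) = m + δ (consPos e a) ((e + m) :: b)

namespace IsDefect

variable {δ : List ℕ → List ℕ → ℕ}

theorem self (h : IsDefect δ) (a : List ℕ) : δ a a = 0 := by
  induction a with
  | nil => exact h.nil
  | cons k a ih => rw [h.cons_cons k a a rfl, ih]

/-- Either reduction has a positive cost, `k` or `l - k`. Pairs of defect 0 therefore have equal
first parts at every stage. -/
theorem pos_of_lt (h : IsDefect δ) {k l : ℕ} {a b : List ℕ} (hk : 0 < k) (hkl : k < l)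
    (hs : (k :: a).sum = (l :: b).sum) : 0 < δ (k :: a) (l :: b) := by
  simp only [List.sum_cons] at hs
  by_cases h2 : 2 * k ≤ l
  · obtain ⟨e, rfl⟩ := Nat.exists_eq_add_of_le h2
    rw [show 2 * k + e = k + e + k by omega, h.short k e a b (by omega)]
    omega
  · obtain ⟨m, rfl⟩ := Nat.exists_eq_add_of_lt hkl
    obtain ⟨e, rfl⟩ := Nat.exists_eq_add_of_le (show m + 1 ≤ k by omega)
    rw [show m + 1 + e + m + 1 = e + (m + 1) + (m + 1) by omega, show m + 1 + e = e + (m + 1) by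
      omega, h.long e (m + 1) a b (by omega)]
    omega

theorem eq_of_eq_zero (h : IsDefect δ) (a b : List ℕ) (ha : ∀ x ∈ a, 0 < x)
    (hb : ∀ x ∈ b, 0 < x) (hs : a.sum = b.sum) (h0 : δ a b = 0) : a = b := by
  induction a generalizing b with
  | nil =>
    cases b with
    | nil => rfl
    | cons l b =>
      have := hb l (by simp)
      simp only [List.sum_nil, List.sum_cons] at hs
      omega
  | cons k a ih =>
    have hk := ha k (by simp)
    cases b with
    | nil =>
      simp only [List.sum_nil, List.sum_cons] at hs
      omega
    | cons l b =>
      have hl := hb l (by simp)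
      rcases lt_trichotomy k l with hkl | rfl | hkl
      · exact absurd h0 (h.pos_of_lt hk hkl hs).ne'
      · simp only [List.sum_cons, Nat.add_left_cancel_iff] at hs
        rw [h.cons_cons k a b hs] at h0
        rw [ih b (fun x hx => ha x (by simp [hx])) (fun x hx => hb x (by simp [hx])) hs h0]
      · rw [h.comm _ _ hs] at h0
        exact absurd h0 (h.pos_of_lt hl hkl hs.symm).ne'

theorem eq_zero_iff (h : IsDefect δ) {a b : List ℕ} (ha : ∀ x ∈ a, 0 < x)
    (hb : ∀ x ∈ b, 0 < x) (hs : a.sum = b.sum) : δ a b = 0 ↔ a = b :=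
  ⟨h.eq_of_eq_zero a b ha hb hs, fun hab => hab ▸ h.self a⟩

/-- The defect of a pair with smaller first part on the left, in terms of smaller pairs. -/
theorem cases_lt (h : IsDefect δ) {k l : ℕ} {a b : List ℕ} (hkl : k < l)
    (hs : (k :: a).sum = (l :: b).sum) :
    (2 * k ≤ l ∧ δ (k :: a) (l :: b) = k + δ a (consPos (l - 2 * k) (k :: b))) ∨
      (l < 2 * k ∧ δ (k :: a) (l :: b) = (l - k) + δ ((2 * k - l) :: a) (k :: b)) := by
  simp only [List.sum_cons] at hs
  by_cases h2 : 2 * k ≤ l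
  · left
    refine ⟨h2, ?_⟩
    obtain ⟨e, rfl⟩ := Nat.exists_eq_add_of_le h2
    rw [show 2 * k + e = k + e + k by omega, h.short k e a b (by omega),
      show k + e + k - 2 * k = e by omega]
  · right
    refine ⟨by omega, ?_⟩
    obtain ⟨m, rfl⟩ := Nat.exists_eq_add_of_lt hkl
    obtain ⟨e, rfl⟩ := Nat.exists_eq_add_of_lt (show m + 1 < k by omega)
    have := h.long (e + 1) (m + 1) a b (by omega)
    rw [consPos_of_pos (by omega)] at this
    rw [show m + 1 + e + 1 + m + 1 = e + 1 + (m + 1) + (m + 1) by omega,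
      show m + 1 + e + 1 = e + 1 + (m + 1) by omega, this]
    congr 3
    all_goals omega

/-- When `l < 2 * k` the defect is at least two: the cost `l - k` is positive, and so is the
remaining defect, its first parts `2 * k - l` and `k` being different. In the other case the cost
must be `k = 1`, and the remaining pair must be equal. -/
theorem eq_one_iff_of_lt (h : IsDefect δ) {k l : ℕ} {a b : List ℕ} (hkl : k < l)
    (ha : ∀ x ∈ k :: a, 0 < x) (hb : ∀ x ∈ l :: b, 0 < x)
    (hs : (k :: a).sum = (l :: b).sum) :
    δ (k :: a) (l :: b) = 1 ↔ k = 1 ∧ a = consPos (l - 2) (1 :: b) := by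
  have hk : 0 < k := ha k (by simp)
  have ha' : ∀ x ∈ a, 0 < x := fun x hx => ha x (by simp [hx])
  have hb' : ∀ x ∈ b, 0 < x := fun x hx => hb x (by simp [hx])
  have hs' := hs
  simp only [List.sum_cons] at hs'
  rcases h.cases_lt hkl hs with ⟨h1, h2⟩ | ⟨h1, h2⟩
  · have h3 := h.eq_zero_iff (a := a) (b := consPos (l - 2 * k) (k :: b)) ha'
      (pos_of_mem_consPos (by simpa [hk] using hb'))
      (by rw [consPos_sum, List.sum_cons]; omega)
    constructor
    · intro h4
      obtain rfl : k = 1 := by omega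
      exact ⟨rfl, h3.1 (by omega)⟩
    · rintro ⟨rfl, h5⟩
      have := h3.2 h5
      omega
  · have h3 := h.pos_of_lt (k := 2 * k - l) (l := k) (a := a) (b := b) (by omega) (by omega)
      (by simp only [List.sum_cons]; omega)
    constructor <;> intro <;> omega

theorem eq_one_iff_of_gt (h : IsDefect δ) {k l : ℕ} {a b : List ℕ} (hkl : l < k)
    (ha : ∀ x ∈ k :: a, 0 < x) (hb : ∀ x ∈ l :: b, 0 < x)
    (hs : (k :: a).sum = (l :: b).sum) :
    δ (k :: a) (l :: b) = 1 ↔ l = 1 ∧ b = consPos (k - 2) (1 :: a) := by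
  rw [h.comm _ _ hs, h.eq_one_iff_of_lt hkl hb ha hs.symm]

/-- The short reduction costs 1 and leaves defect 1, or costs 2 and leaves an equal pair. The long
one must cost 1 and leave defect 1 with first parts `k - 1 < k`; then `k - 1 = 1`, so `k = 2` and `l
= 3`. -/
theorem eq_two_iff_of_lt (h : IsDefect δ) {k l : ℕ} {a b : List ℕ} (hkl : k < l)
    (ha : ∀ x ∈ k :: a, 0 < x) (hb : ∀ x ∈ l :: b, 0 < x)
    (hs : (k :: a).sum = (l :: b).sum) :
    δ (k :: a) (l :: b) = 2 ↔ (k = 1 ∧ δ a (consPos (l - 2) (1 :: b)) = 1) ∨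
      (k = 2 ∧ 4 ≤ l ∧ a = consPos (l - 4) (2 :: b)) ∨ (k = 2 ∧ l = 3 ∧ a = 1 :: b) := by
  have hk : 0 < k := ha k (by simp)
  have ha' : ∀ x ∈ a, 0 < x := fun x hx => ha x (by simp [hx])
  have hb' : ∀ x ∈ b, 0 < x := fun x hx => hb x (by simp [hx])
  have hs' := hs
  simp only [List.sum_cons] at hs'
  rcases h.cases_lt hkl hs with ⟨h1, h2⟩ | ⟨h1, h2⟩
  · have h3 := h.eq_zero_iff (a := a) (b := consPos (l - 2 * k) (k :: b)) ha'
      (pos_of_mem_consPos (by simpa [hk] using hb'))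
      (by rw [consPos_sum, List.sum_cons]; omega)
    constructor
    · intro h4
      obtain rfl | rfl : k = 1 ∨ k = 2 := by omega
      · left
        refine ⟨rfl, ?_⟩
        rw [mul_one] at h2
        omega
      · exact Or.inr (Or.inl ⟨rfl, by omega, h3.1 (by omega)⟩)
    · rintro (⟨rfl, h5⟩ | ⟨rfl, -, h5⟩ | ⟨rfl, h5, -⟩)
      · rw [mul_one] at h2
        omega
      · have := h3.2 h5
        omega
      · omega
  · have hlt : 2 * k - l < k := by omega
    have hs2 : ((2 * k - l) :: a).sum = (k :: b).sum := by
      simp only [List.sum_cons]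
      omega
    have h3 := h.pos_of_lt (by omega) hlt hs2
    have h4 := h.eq_one_iff_of_lt hlt (by simpa using ⟨by omega, ha'⟩)
      (by simpa using ⟨by omega, hb'⟩) hs2
    constructor
    · intro h5
      obtain ⟨h6, h7⟩ := h4.1 (by omega)
      obtain rfl : k = 2 := by omega
      exact Or.inr (Or.inr ⟨rfl, by omega, h7⟩)
    · rintro (⟨rfl, h5⟩ | ⟨rfl, h5, -⟩ | ⟨rfl, rfl, h5⟩)
      · omega
      · omega
      · have := h4.2 ⟨rfl, h5⟩
        omega

end IsDefect

/-! ### Counting pairs of compositions by explicit bijections. -/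

/-- The compositions of `n`, as lists. -/
def comps (n : ℕ) : Finset (List ℕ) := Finset.univ.image (Composition.blocks (n := n))

theorem mem_comps {n : ℕ} {l : List ℕ} : l ∈ comps n ↔ (∀ x ∈ l, 0 < x) ∧ l.sum = n := by
  rw [comps, Finset.mem_image]
  constructor
  · rintro ⟨c, -, rfl⟩
    exact ⟨fun x hx => c.blocks_pos hx, c.blocks_sum⟩
  · rintro ⟨h1, h2⟩
    exact ⟨⟨l, fun {x} hx => h1 x hx, h2⟩, Finset.mem_univ _, rfl⟩

theorem Composition.blocks_injective (n : ℕ) :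
    Function.Injective (Composition.blocks (n := n)) := fun _ _ h => Composition.ext h

theorem card_comps (n : ℕ) : (comps n).card = 2 ^ (n - 1) := by
  rw [comps, Finset.card_image_of_injective _ (Composition.blocks_injective n),
    Finset.card_univ, composition_card]

theorem cons_mem_comps {n k : ℕ} {l : List ℕ} :
    k :: l ∈ comps n ↔ 0 < k ∧ k ≤ n ∧ l ∈ comps (n - k) := by
  simp only [mem_comps, List.mem_cons, forall_eq_or_imp, List.sum_cons]
  constructor
  · rintro ⟨⟨h1, h2⟩, h3⟩
    exact ⟨h1, by omega, h2, by omega⟩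
  · rintro ⟨h1, h2, h3, h4⟩
    exact ⟨⟨h1, h3⟩, by omega⟩

theorem consPos_mem_comps {n k : ℕ} {l : List ℕ} :
    consPos k l ∈ comps n ↔ k ≤ n ∧ l ∈ comps (n - k) := by
  rcases Nat.eq_zero_or_pos k with rfl | hk
  · simp [consPos_zero]
  · rw [consPos_of_pos hk, cons_mem_comps]
    exact and_iff_right hk

theorem comps_zero : comps 0 = {[]} := by
  ext l
  cases l with
  | nil => simp [mem_comps]
  | cons k l =>
    rw [cons_mem_comps]
    simp
    omega

theorem exists_cons_of_mem_comps {n : ℕ} {l : List ℕ} (h : l ∈ comps n) (hn : 0 < n) :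
    ∃ k t, l = k :: t ∧ 0 < k ∧ k ≤ n ∧ t ∈ comps (n - k) := by
  cases l with
  | nil =>
    rw [mem_comps] at h
    simp only [List.sum_nil] at h
    omega
  | cons k t => exact ⟨k, t, rfl, cons_mem_comps.1 h⟩

open Classical in
/-- The number of pairs of compositions of `n` with a given property. -/
noncomputable def cnt (n : ℕ) (Q : List ℕ → List ℕ → Prop) : ℕ :=
  ((comps n ×ˢ comps n).filter fun p => Q p.1 p.2).card

theorem cnt_congr {n : ℕ} {Q R : List ℕ → List ℕ → Prop}
    (h : ∀ a ∈ comps n, ∀ b ∈ comps n, (Q a b ↔ R a b)) : cnt n Q = cnt n R := by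
  classical
  unfold cnt
  congr 1
  refine Finset.filter_congr fun p hp => ?_
  rw [Finset.mem_product] at hp
  exact h _ hp.1 _ hp.2

theorem cnt_or {n : ℕ} {Q R : List ℕ → List ℕ → Prop} (h : ∀ a b, Q a b → ¬ R a b) :
    cnt n (fun a b => Q a b ∨ R a b) = cnt n Q + cnt n R := by
  classical
  unfold cnt
  rw [← Finset.card_union_of_disjoint (Finset.disjoint_filter.2 fun p _ => h _ _),
    ← Finset.filter_or]
  congr!

/-- The common counting device: `(f j, g j)` parametrizes the pairs counted on the left by pairs of
compositions of the various `j` in `I`. -/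
theorem cnt_eq_sum {n : ℕ} {Q R : List ℕ → List ℕ → Prop} (I : Finset ℕ)
    (f g : ℕ → List ℕ → List ℕ → List ℕ)
    (hmap : ∀ j ∈ I, ∀ a ∈ comps j, ∀ b ∈ comps j, R a b →
      f j a b ∈ comps n ∧ g j a b ∈ comps n ∧ Q (f j a b) (g j a b))
    (hinj : ∀ j ∈ I, ∀ a ∈ comps j, ∀ b ∈ comps j, R a b → ∀ j' ∈ I, ∀ a' ∈ comps j',
      ∀ b' ∈ comps j', R a' b' → f j a b = f j' a' b' → g j a b = g j' a' b' →
      j = j' ∧ a = a' ∧ b = b')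
    (hsurj : ∀ a ∈ comps n, ∀ b ∈ comps n, Q a b → ∃ j ∈ I, ∃ a' ∈ comps j, ∃ b' ∈ comps j,
      R a' b' ∧ f j a' b' = a ∧ g j a' b' = b) :
    cnt n Q = ∑ j ∈ I, cnt j R := by
  classical
  unfold cnt
  rw [← Finset.card_sigma]
  symm
  refine Finset.card_bij (fun x _ => (f x.1 x.2.1 x.2.2, g x.1 x.2.1 x.2.2)) ?_ ?_ ?_
  · rintro ⟨j, a, b⟩ hx
    simp only [Finset.mem_sigma, Finset.mem_filter, Finset.mem_product] at hx ⊢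
    obtain ⟨h1, h2, h3⟩ := hmap j hx.1 a hx.2.1.1 b hx.2.1.2 hx.2.2
    exact ⟨⟨h1, h2⟩, h3⟩
  · rintro ⟨j, a, b⟩ hx ⟨j', a', b'⟩ hx' heq
    simp only [Finset.mem_sigma, Finset.mem_filter, Finset.mem_product] at hx hx'
    rw [Prod.mk.injEq] at heq
    obtain ⟨rfl, rfl, rfl⟩ := hinj j hx.1 a hx.2.1.1 b hx.2.1.2 hx.2.2 j' hx'.1 a' hx'.2.1.1 b'
      hx'.2.1.2 hx'.2.2 heq.1 heq.2
    rfl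
  · rintro ⟨a, b⟩ hab
    simp only [Finset.mem_filter, Finset.mem_product] at hab
    obtain ⟨j, hj, a', ha', b', hb', h1, rfl, rfl⟩ := hsurj a hab.1.1 b hab.1.2 hab.2
    refine ⟨⟨j, a', b'⟩, ?_, rfl⟩
    simp only [Finset.mem_sigma, Finset.mem_filter, Finset.mem_product]
    exact ⟨hj, ⟨ha', hb'⟩, h1⟩

theorem cnt_eq (n : ℕ) : cnt n (fun a b => a = b) = 2 ^ (n - 1) := by
  classical
  rw [← card_comps, cnt]
  symm
  refine Finset.card_bij (fun a _ => (a, a)) ?_ ?_ ?_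
  · intro a ha
    simp [ha]
  · intro a _ b _ h
    exact (Prod.mk.inj h).1
  · rintro ⟨a, b⟩ h
    simp only [Finset.mem_filter, Finset.mem_product] at h
    exact ⟨a, h.1.1, by rw [h.2]⟩

/-- Pairs parametrized by the compositions of `m`. -/
theorem cnt_graph {n : ℕ} {Q : List ℕ → List ℕ → Prop} (m : ℕ) (f g : List ℕ → List ℕ)
    (hmap : ∀ a ∈ comps m, f a ∈ comps n ∧ g a ∈ comps n ∧ Q (f a) (g a))
    (hinj : ∀ a ∈ comps m, ∀ a' ∈ comps m, g a = g a' → a = a')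
    (hsurj : ∀ a ∈ comps n, ∀ b ∈ comps n, Q a b → ∃ a' ∈ comps m, f a' = a ∧ g a' = b) :
    cnt n Q = 2 ^ (m - 1) := by
  rw [← cnt_eq, cnt_eq_sum (R := fun a b => a = b) {m} (fun _ a _ => f a) (fun _ a _ => g a),
    Finset.sum_singleton]
  · intro j hj a ha b _ _
    rw [Finset.mem_singleton] at hj
    subst hj
    exact hmap a ha
  · intro j hj a ha b _ hab j' hj' a' ha' b' _ hab' _ h2
    rw [Finset.mem_singleton] at hj hj'
    subst hj hab hab'
    subst hj'
    have := hinj a ha a' ha' h2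
    exact ⟨rfl, this, this⟩
  · intro a ha b hb hab
    obtain ⟨a', ha', h1, h2⟩ := hsurj a ha b hb hab
    exact ⟨m, Finset.mem_singleton_self m, a', ha', a', ha', rfl, h1, h2⟩

theorem cnt_swap (n : ℕ) (Q : List ℕ → List ℕ → Prop) : cnt n (fun a b => Q b a) = cnt n Q := by
  rw [cnt_eq_sum (Q := fun a b => Q b a) (R := Q) {n} (fun _ _ b => b) (fun _ a _ => a),
    Finset.sum_singleton]
  · intro j hj a ha b hb h
    rw [Finset.mem_singleton] at hj
    subst hj
    exact ⟨hb, ha, h⟩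
  · intro j hj a _ b _ _ j' hj' a' _ b' _ _ h1 h2
    rw [Finset.mem_singleton] at hj hj'
    exact ⟨hj.trans hj'.symm, h2, h1⟩
  · intro a ha b hb h
    exact ⟨n, Finset.mem_singleton_self n, b, hb, a, ha, h, rfl, rfl⟩

/-! ### Numbers of pairs of defect zero, one and two. -/

namespace IsDefect

variable {δ : List ℕ → List ℕ → ℕ}

theorem one_iff_of_lt (h : IsDefect δ) {n k l : ℕ} {a b : List ℕ} (ha : k :: a ∈ comps n)
    (hb : l :: b ∈ comps n) (hkl : k < l) :
    δ (k :: a) (l :: b) = 1 ↔ k = 1 ∧ a = consPos (l - 2) (1 :: b) := by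
  rw [mem_comps] at ha hb
  exact h.eq_one_iff_of_lt hkl ha.1 hb.1 (ha.2.trans hb.2.symm)

theorem one_iff_of_gt (h : IsDefect δ) {n k l : ℕ} {a b : List ℕ} (ha : k :: a ∈ comps n)
    (hb : l :: b ∈ comps n) (hkl : l < k) :
    δ (k :: a) (l :: b) = 1 ↔ l = 1 ∧ b = consPos (k - 2) (1 :: a) := by
  rw [mem_comps] at ha hb
  exact h.eq_one_iff_of_gt hkl ha.1 hb.1 (ha.2.trans hb.2.symm)

theorem two_iff_of_lt (h : IsDefect δ) {n k l : ℕ} {a b : List ℕ} (ha : k :: a ∈ comps n)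
    (hb : l :: b ∈ comps n) (hkl : k < l) :
    δ (k :: a) (l :: b) = 2 ↔ (k = 1 ∧ δ a (consPos (l - 2) (1 :: b)) = 1) ∨
      (k = 2 ∧ 4 ≤ l ∧ a = consPos (l - 4) (2 :: b)) ∨ (k = 2 ∧ l = 3 ∧ a = 1 :: b) := by
  rw [mem_comps] at ha hb
  exact h.eq_two_iff_of_lt hkl ha.1 hb.1 (ha.2.trans hb.2.symm)

theorem cons_cons_of_mem (h : IsDefect δ) {n k : ℕ} {a b : List ℕ} (ha : a ∈ comps n)
    (hb : b ∈ comps n) : δ (k :: a) (k :: b) = δ a b := by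
  rw [mem_comps] at ha hb
  exact h.cons_cons k a b (ha.2.trans hb.2.symm)

/-- Splitting off a common first part. -/
theorem cnt_rec (h : IsDefect δ) (d : ℕ) {n : ℕ} (hn : 0 < n) :
    cnt n (fun a b => δ a b = d) = ∑ j ∈ Finset.range n, cnt j (fun a b => δ a b = d) +
      2 * cnt n (fun a b => a.headI < b.headI ∧ δ a b = d) := by
  have h1 : cnt n (fun a b => δ a b = d) =
      cnt n (fun a b => (a.headI = b.headI ∧ δ a b = d) ∨ ((a.headI < b.headI ∧ δ a b = d) ∨
        (b.headI < a.headI ∧ δ b a = d))) := by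
    refine cnt_congr fun a ha b hb => ?_
    rw [h.comm b a ((mem_comps.1 hb).2.trans (mem_comps.1 ha).2.symm)]
    omega
  rw [h1, cnt_or (by intro a b; omega), cnt_or (by intro a b; omega),
    cnt_swap n fun a b => a.headI < b.headI ∧ δ a b = d, two_mul]
  congr 1
  -- Here `j` is the sum remaining after the common first part `n - j`.
  refine cnt_eq_sum (Finset.range n) (fun j a _ => (n - j) :: a) (fun j _ b => (n - j) :: b)
    ?_ ?_ ?_
  · intro j hj a ha b hb hab
    rw [Finset.mem_range] at hj
    have hj' : n - (n - j) = j := by omega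
    refine ⟨cons_mem_comps.2 ⟨by omega, by omega, by rwa [hj']⟩,
      cons_mem_comps.2 ⟨by omega, by omega, by rwa [hj']⟩, rfl, ?_⟩
    rw [h.cons_cons_of_mem ha hb, hab]
  · intro j hj a _ b _ _ j' hj' a' _ b' _ _ h2 h3
    rw [Finset.mem_range] at hj hj'
    rw [List.cons.injEq] at h2 h3
    exact ⟨by omega, h2.2, h3.2⟩
  · rintro a ha b hb ⟨h2, h3⟩
    obtain ⟨k, a, rfl, hk, hkn, ha'⟩ := exists_cons_of_mem_comps ha hn
    obtain ⟨l, b, rfl, hl, hln, hb'⟩ := exists_cons_of_mem_comps hb hn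
    simp only [List.headI_cons] at h2
    subst h2
    refine ⟨n - k, by rw [Finset.mem_range]; omega, a, ha', b, hb', ?_, ?_, ?_⟩
    · rw [← h.cons_cons_of_mem ha' hb', h3]
    · simp only [Nat.sub_sub_self hkn]
    · simp only [Nat.sub_sub_self hkn]

/-- Such a pair is determined by its second member, any composition with first part at least 2.
Lowering that part by one gives an arbitrary composition of `n - 1`. -/
theorem cnt_lt_one (h : IsDefect δ) {n : ℕ} (hn : 2 ≤ n) :
    cnt n (fun a b => a.headI < b.headI ∧ δ a b = 1) = 2 ^ (n - 2) := by
  refine cnt_graph (n - 1) (fun l => 1 :: consPos (l.headI - 1) (1 :: l.tail))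
    (fun l => (l.headI + 1) :: l.tail) ?_ ?_ ?_
  · intro a ha
    obtain ⟨k, a, rfl, hk, hkn, ha'⟩ := exists_cons_of_mem_comps ha (by omega)
    simp only [List.headI_cons, List.tail_cons]
    have h1 : 1 :: consPos (k - 1) (1 :: a) ∈ comps n :=
      cons_mem_comps.2 ⟨by omega, by omega, consPos_mem_comps.2 ⟨by omega,
        cons_mem_comps.2 ⟨by omega, by omega, by convert ha' using 2; omega⟩⟩⟩
    have h2 : (k + 1) :: a ∈ comps n :=
      cons_mem_comps.2 ⟨by omega, by omega, by convert ha' using 2; omega⟩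
    refine ⟨h1, h2, by omega, (h.one_iff_of_lt h1 h2 (by omega)).2 ⟨rfl, ?_⟩⟩
    rw [show k + 1 - 2 = k - 1 by omega]
  · intro a ha a' ha' heq
    obtain ⟨k, a, rfl, -⟩ := exists_cons_of_mem_comps ha (by omega)
    obtain ⟨k', a', rfl, -⟩ := exists_cons_of_mem_comps ha' (by omega)
    simpa using heq
  · rintro a ha b hb ⟨h2, h3⟩
    obtain ⟨k, a, rfl, hk, hkn, ha'⟩ := exists_cons_of_mem_comps ha (by omega)
    obtain ⟨l, b, rfl, hl, hln, hb'⟩ := exists_cons_of_mem_comps hb (by omega)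
    simp only [List.headI_cons] at h2
    obtain ⟨rfl, rfl⟩ := (h.one_iff_of_lt ha hb h2).1 h3
    refine ⟨(l - 1) :: b, cons_mem_comps.2 ⟨by omega, by omega, by convert hb' using 2; omega⟩,
      ?_, ?_⟩
    · simp only [List.headI_cons, List.tail_cons]
      rw [show l - 1 - 1 = l - 2 by omega]
    · simp only [List.headI_cons, List.tail_cons]
      rw [show l - 1 + 1 = l by omega]

/-- Either both first parts are 1 and cancel, or the first part of `a` is larger; in that case
defect 1 already forces the smaller first part to be 1. -/
theorem cnt_head_one (h : IsDefect δ) {n : ℕ} (hn : 2 ≤ n) :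
    cnt n (fun a b => b.headI = 1 ∧ δ a b = 1) =
      cnt (n - 1) (fun a b => δ a b = 1) + 2 ^ (n - 2) := by
  have h1 : cnt n (fun a b => b.headI = 1 ∧ δ a b = 1) =
      cnt n (fun a b => (a.headI = 1 ∧ b.headI = 1 ∧ δ a b = 1) ∨
        (b.headI < a.headI ∧ δ b a = 1)) := by
    refine cnt_congr fun a ha b hb => ?_
    rw [h.comm b a ((mem_comps.1 hb).2.trans (mem_comps.1 ha).2.symm)]
    obtain ⟨k, a, rfl, hk, hkn, ha'⟩ := exists_cons_of_mem_comps ha (by omega)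
    obtain ⟨l, b, rfl, hl, hln, hb'⟩ := exists_cons_of_mem_comps hb (by omega)
    simp only [List.headI_cons]
    constructor
    · rintro ⟨rfl, h2⟩
      omega
    · rintro (⟨-, h2⟩ | ⟨h2, h3⟩)
      · exact h2
      · exact ⟨((h.one_iff_of_gt ha hb h2).1 h3).1, h3⟩
  rw [h1, cnt_or (by intro a b; omega), cnt_swap n fun a b => a.headI < b.headI ∧ δ a b = 1,
    h.cnt_lt_one hn]
  congr 1
  rw [cnt_eq_sum (R := fun a b => δ a b = 1) {n - 1} (fun _ a _ => 1 :: a) (fun _ _ b => 1 :: b),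
    Finset.sum_singleton]
  · intro j hj a ha b hb hab
    rw [Finset.mem_singleton] at hj
    subst hj
    refine ⟨cons_mem_comps.2 ⟨by omega, by omega, ha⟩, cons_mem_comps.2 ⟨by omega, by omega, hb⟩,
      rfl, rfl, ?_⟩
    rw [h.cons_cons_of_mem ha hb, hab]
  · intro j hj a _ b _ _ j' hj' a' _ b' _ _ h2 h3
    rw [Finset.mem_singleton] at hj hj'
    rw [List.cons.injEq] at h2 h3
    exact ⟨by omega, h2.2, h3.2⟩
  · rintro a ha b hb ⟨h2, h3, h4⟩
    obtain ⟨k, a, rfl, hk, hkn, ha'⟩ := exists_cons_of_mem_comps ha (by omega)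
    obtain ⟨l, b, rfl, hl, hln, hb'⟩ := exists_cons_of_mem_comps hb (by omega)
    simp only [List.headI_cons] at h2 h3
    subst h2 h3
    refine ⟨n - 1, Finset.mem_singleton_self _, a, ha', b, hb', ?_, rfl, rfl⟩
    rw [← h.cons_cons_of_mem ha' hb', h4]

/-- With first parts 1 and 2 the short reduction has `e = 0` and leaves `a | 1, b`. -/
theorem cnt_two_one_two (h : IsDefect δ) {n : ℕ} (hn : 2 ≤ n) :
    cnt n (fun a b => a.headI = 1 ∧ b.headI = 2 ∧ δ a b = 2) =
      cnt (n - 1) (fun a b => b.headI = 1 ∧ δ a b = 1) := by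
  rw [cnt_eq_sum (R := fun a b => b.headI = 1 ∧ δ a b = 1) {n - 1} (fun _ a _ => 1 :: a)
    (fun _ _ b => 2 :: b.tail), Finset.sum_singleton]
  · rintro j hj a ha b hb ⟨hb1, hab⟩
    rw [Finset.mem_singleton] at hj
    subst hj
    obtain ⟨l, b, rfl, hl, hln, hb'⟩ := exists_cons_of_mem_comps hb (by omega)
    simp only [List.headI_cons, List.tail_cons] at hb1 ⊢
    subst hb1
    have h1 : 1 :: a ∈ comps n := cons_mem_comps.2 ⟨by omega, by omega, ha⟩
    have h2 : 2 :: b ∈ comps n :=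
      cons_mem_comps.2 ⟨by omega, by omega, by convert hb' using 2; omega⟩
    exact ⟨h1, h2, trivial, trivial, (h.two_iff_of_lt h1 h2 (by omega)).2 (Or.inl ⟨rfl, hab⟩)⟩
  · rintro j hj a ha b hb ⟨hb1, -⟩ j' hj' a' ha' b' hb' ⟨hb1', -⟩ h2 h3
    rw [Finset.mem_singleton] at hj hj'
    subst hj hj'
    obtain ⟨l, b, rfl, -⟩ := exists_cons_of_mem_comps hb (by omega)
    obtain ⟨l', b', rfl, -⟩ := exists_cons_of_mem_comps hb' (by omega)
    simp only [List.headI_cons, List.tail_cons, List.cons.injEq, true_and] at *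
    exact ⟨h2, hb1.trans hb1'.symm, h3⟩
  · rintro a ha b hb ⟨h2, h3, h4⟩
    obtain ⟨k, a, rfl, hk, hkn, ha'⟩ := exists_cons_of_mem_comps ha (by omega)
    obtain ⟨l, b, rfl, hl, hln, hb'⟩ := exists_cons_of_mem_comps hb (by omega)
    simp only [List.headI_cons] at h2 h3
    subst h2 h3
    refine ⟨n - 1, Finset.mem_singleton_self _, a, ha', 1 :: b,
      cons_mem_comps.2 ⟨by omega, by omega, by convert hb' using 2; omega⟩, ⟨rfl, ?_⟩, rfl, rfl⟩
    have h5 := (h.two_iff_of_lt ha hb (by omega)).1 h4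
    rcases h5 with h5 | h5 | h5
    · exact h5.2
    · omega
    · omega

/-- After the short reduction the new first parts are equal and cancel, leaving a pair of defect 1
whose second member starts with 1. -/
theorem cnt_two_equal_second (h : IsDefect δ) {n : ℕ} (hn : 2 ≤ n) :
    cnt n (fun a b => a.headI = 1 ∧ 3 ≤ b.headI ∧ a.tail.headI + 2 = b.headI ∧ δ a b = 2) =
      ∑ j ∈ Finset.range (n - 1), cnt j (fun a b => b.headI = 1 ∧ δ a b = 1) := by
  refine cnt_eq_sum (Finset.range (n - 1)) (fun j a _ => 1 :: (n - 1 - j) :: a)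
    (fun j _ b => (n + 1 - j) :: b.tail) ?_ ?_ ?_
  · rintro j hj a ha b hb ⟨hb1, hab⟩
    rw [Finset.mem_range] at hj
    have hj0 : 0 < j := by
      rw [Nat.pos_iff_ne_zero]
      rintro rfl
      rw [comps_zero, Finset.mem_singleton] at hb
      subst hb
      simp at hb1
    obtain ⟨l, b, rfl, hl, hln, hb'⟩ := exists_cons_of_mem_comps hb hj0
    simp only [List.headI_cons, List.tail_cons] at hb1 ⊢
    subst hb1
    have h1 : 1 :: (n - 1 - j) :: a ∈ comps n := cons_mem_comps.2 ⟨by omega, by omega,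
      cons_mem_comps.2 ⟨by omega, by omega, by convert ha using 2; omega⟩⟩
    have h2 : (n + 1 - j) :: b ∈ comps n :=
      cons_mem_comps.2 ⟨by omega, by omega, by convert hb' using 2; omega⟩
    refine ⟨h1, h2, trivial, by omega, by omega, (h.two_iff_of_lt h1 h2 (by omega)).2
      (Or.inl ⟨rfl, ?_⟩)⟩
    rw [show n + 1 - j - 2 = n - 1 - j by omega, consPos_of_pos (by omega),
      h.cons_cons_of_mem ha hb, hab]
  · rintro j hj a ha b hb ⟨hb1, -⟩ j' hj' a' ha' b' hb' ⟨hb1', -⟩ h2 h3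
    rw [Finset.mem_range] at hj hj'
    simp only [List.cons.injEq, true_and] at h2 h3
    obtain rfl : j = j' := by omega
    have hj0 : 0 < j := by
      rw [Nat.pos_iff_ne_zero]
      rintro rfl
      rw [comps_zero, Finset.mem_singleton] at hb
      subst hb
      simp at hb1
    obtain ⟨l, b, rfl, -⟩ := exists_cons_of_mem_comps hb hj0
    obtain ⟨l', b', rfl, -⟩ := exists_cons_of_mem_comps hb' hj0
    simp only [List.headI_cons, List.tail_cons] at hb1 hb1' h3
    rw [hb1, hb1', h3.2, h2.2]
    exact ⟨rfl, rfl, rfl⟩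
  · rintro a ha b hb ⟨h2, h3, h4, h5⟩
    obtain ⟨k, a, rfl, hk, hkn, ha'⟩ := exists_cons_of_mem_comps ha (by omega)
    obtain ⟨l, b, rfl, hl, hln, hb'⟩ := exists_cons_of_mem_comps hb (by omega)
    simp only [List.headI_cons, List.tail_cons] at h2 h3 h4
    subst h2
    obtain ⟨k, a, rfl, hk, hkn', ha''⟩ := exists_cons_of_mem_comps ha' (by omega)
    simp only [List.headI_cons] at h4
    subst h4
    have h6 : 1 :: b ∈ comps (n - 1 - k) :=
      cons_mem_comps.2 ⟨by omega, by omega, by convert hb' using 2; omega⟩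
    refine ⟨n - 1 - k, by rw [Finset.mem_range]; omega, a, ha'', 1 :: b, h6, ⟨rfl, ?_⟩, ?_, ?_⟩
    · rcases (h.two_iff_of_lt ha hb (by omega)).1 h5 with h7 | h7 | h7
      · rw [Nat.add_sub_cancel, consPos_of_pos hk, h.cons_cons_of_mem ha'' h6] at h7
        exact h7.2
      · omega
      · omega
    · rw [show n - 1 - (n - 1 - k) = k by omega]
    · rw [show n + 1 - (n - 1 - k) = k + 2 by omega]
      rfl

/-- After the reduction the left first part is the smaller one, so it must be 1 and `b` determines
`a`. The first part of `b` is at least 4; lowering it by 3 gives a composition of `n - 3`. -/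
theorem cnt_two_second_lt (h : IsDefect δ) {n : ℕ} (hn : 4 ≤ n) :
    cnt n (fun a b => a.headI = 1 ∧ 3 ≤ b.headI ∧ a.tail.headI + 2 < b.headI ∧ δ a b = 2) =
      2 ^ (n - 4) := by
  refine cnt_graph (n - 3) (fun l => 1 :: 1 :: consPos (l.headI - 1) (1 :: 1 :: l.tail))
    (fun l => (l.headI + 3) :: l.tail) ?_ ?_ ?_
  · intro a ha
    obtain ⟨k, a, rfl, hk, hkn, ha'⟩ := exists_cons_of_mem_comps ha (by omega)
    simp only [List.headI_cons, List.tail_cons]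
    have h0 : 1 :: consPos (k - 1) (1 :: 1 :: a) ∈ comps (n - 1) :=
      cons_mem_comps.2 ⟨by omega, by omega, consPos_mem_comps.2 ⟨by omega,
        cons_mem_comps.2 ⟨by omega, by omega,
        cons_mem_comps.2 ⟨by omega, by omega, by convert ha' using 2; omega⟩⟩⟩⟩
    have h1 : 1 :: 1 :: consPos (k - 1) (1 :: 1 :: a) ∈ comps n :=
      cons_mem_comps.2 ⟨by omega, by omega, h0⟩
    have h2 : (k + 3) :: a ∈ comps n :=
      cons_mem_comps.2 ⟨by omega, by omega, by convert ha' using 2; omega⟩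
    have h3 : (k + 1) :: 1 :: a ∈ comps (n - 1) :=
      cons_mem_comps.2 ⟨by omega, by omega,
        cons_mem_comps.2 ⟨by omega, by omega, by convert ha' using 2; omega⟩⟩
    refine ⟨h1, h2, trivial, by omega, by omega, (h.two_iff_of_lt h1 h2 (by omega)).2
      (Or.inl ⟨rfl, ?_⟩)⟩
    rw [show k + 3 - 2 = k + 1 by omega, consPos_of_pos (k := k + 1) (by omega),
      h.one_iff_of_lt h0 h3 (by omega)]
    refine ⟨rfl, ?_⟩
    rw [show k + 1 - 2 = k - 1 by omega]
  · intro a ha a' ha' heq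
    obtain ⟨k, a, rfl, -⟩ := exists_cons_of_mem_comps ha (by omega)
    obtain ⟨k', a', rfl, -⟩ := exists_cons_of_mem_comps ha' (by omega)
    simpa using heq
  · rintro a ha b hb ⟨h2, h3, h4, h5⟩
    obtain ⟨k, a, rfl, hk, hkn, ha'⟩ := exists_cons_of_mem_comps ha (by omega)
    obtain ⟨l, b, rfl, hl, hln, hb'⟩ := exists_cons_of_mem_comps hb (by omega)
    simp only [List.headI_cons, List.tail_cons] at h2 h3 h4
    subst h2
    obtain ⟨k, a, rfl, hk, hkn', ha''⟩ := exists_cons_of_mem_comps ha' (by omega)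
    simp only [List.headI_cons] at h4
    have h6 : (l - 2) :: 1 :: b ∈ comps (n - 1) :=
      cons_mem_comps.2 ⟨by omega, by omega,
        cons_mem_comps.2 ⟨by omega, by omega, by convert hb' using 2; omega⟩⟩
    rcases (h.two_iff_of_lt ha hb (by omega)).1 h5 with h7 | h7 | h7
    · have h8 := h7.2
      rw [consPos_of_pos (by omega), h.one_iff_of_lt ha' h6 (by omega)] at h8
      obtain ⟨rfl, rfl⟩ := h8
      refine ⟨(l - 3) :: b, cons_mem_comps.2 ⟨by omega, by omega, by convert hb' using 2; omega⟩,
        ?_, ?_⟩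
      · simp only [List.headI_cons, List.tail_cons]
        rw [show l - 3 - 1 = l - 2 - 2 by omega]
      · simp only [List.headI_cons, List.tail_cons]
        rw [show l - 3 + 3 = l by omega]
    · omega
    · omega

/-- After the reduction the right first part is the smaller one and must be 1, so `b` starts with 3.
The pairs are `1, 2, t | 3, t`. -/
theorem cnt_two_second_two (h : IsDefect δ) {n : ℕ} (hn : 3 ≤ n) :
    cnt n (fun a b => a.headI = 1 ∧ 3 ≤ b.headI ∧ b.headI < a.tail.headI + 2 ∧ a.tail.headI = 2 ∧
      δ a b = 2) = 2 ^ (n - 4) := by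
  refine cnt_graph (n - 3) (fun l => 1 :: 2 :: l) (fun l => 3 :: l) ?_ ?_ ?_
  · intro a ha
    have h0 : 2 :: a ∈ comps (n - 1) := cons_mem_comps.2 ⟨by omega, by omega, ha⟩
    have h1 : 1 :: 2 :: a ∈ comps n := cons_mem_comps.2 ⟨by omega, by omega, h0⟩
    have h2 : 3 :: a ∈ comps n := cons_mem_comps.2 ⟨by omega, by omega, ha⟩
    have h3 : 1 :: 1 :: a ∈ comps (n - 1) :=
      cons_mem_comps.2 ⟨by omega, by omega, cons_mem_comps.2 ⟨by omega, by omega, ha⟩⟩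
    exact ⟨h1, h2, rfl, le_rfl, by simp, rfl, (h.two_iff_of_lt h1 h2 (by omega)).2
      (Or.inl ⟨rfl, (h.one_iff_of_gt h0 h3 (by omega)).2 ⟨rfl, rfl⟩⟩)⟩
  · intro a _ a' _ heq
    exact (List.cons.inj heq).2
  · rintro a ha b hb ⟨h2, h3, h4, h5, h6⟩
    obtain ⟨k, a, rfl, hk, hkn, ha'⟩ := exists_cons_of_mem_comps ha (by omega)
    obtain ⟨l, b, rfl, hl, hln, hb'⟩ := exists_cons_of_mem_comps hb (by omega)
    simp only [List.headI_cons, List.tail_cons] at h2 h3 h4 h5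
    subst h2
    obtain ⟨k, a, rfl, hk, hkn', ha''⟩ := exists_cons_of_mem_comps ha' (by omega)
    simp only [List.headI_cons] at h4 h5
    subst h5
    obtain rfl : l = 3 := by omega
    have h7 : 1 :: 1 :: b ∈ comps (n - 1) :=
      cons_mem_comps.2 ⟨by omega, by omega, cons_mem_comps.2 ⟨by omega, by omega, hb'⟩⟩
    rcases (h.two_iff_of_lt ha hb (by omega)).1 h6 with h8 | h8 | h8
    · have h9 := ((h.one_iff_of_gt ha' h7 (by omega)).1 h8.2).2
      have h10 : b = a := (List.cons.inj h9).2
      exact ⟨b, hb', by rw [h10], rfl⟩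
    · omega
    · omega

/-- As in the preceding case `b` starts with 3, but the nonzero remainder `k - 2` of the second part
`k` of `a` must match a part 1. The pairs are `1, 3, t | 3, 1, t`; for `n = 4` the truncated
exponent correctly counts the empty `t`. -/
theorem cnt_two_second_three (h : IsDefect δ) {n : ℕ} (hn : 4 ≤ n) :
    cnt n (fun a b => a.headI = 1 ∧ 3 ≤ b.headI ∧ b.headI < a.tail.headI + 2 ∧ a.tail.headI ≠ 2 ∧
      δ a b = 2) = 2 ^ (n - 5) := by
  refine cnt_graph (n - 4) (fun l => 1 :: 3 :: l) (fun l => 3 :: 1 :: l) ?_ ?_ ?_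
  · intro a ha
    have h0 : 3 :: a ∈ comps (n - 1) := cons_mem_comps.2 ⟨by omega, by omega, ha⟩
    have h1 : 1 :: 3 :: a ∈ comps n := cons_mem_comps.2 ⟨by omega, by omega, h0⟩
    have h4 : 1 :: a ∈ comps (n - 3) := cons_mem_comps.2 ⟨by omega, by omega, ha⟩
    have h2 : 3 :: 1 :: a ∈ comps n := cons_mem_comps.2 ⟨by omega, by omega, h4⟩
    have h3 : 1 :: 1 :: 1 :: a ∈ comps (n - 1) :=
      cons_mem_comps.2 ⟨by omega, by omega, cons_mem_comps.2 ⟨by omega, by omega, h4⟩⟩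
    exact ⟨h1, h2, rfl, le_rfl, by simp, by simp, (h.two_iff_of_lt h1 h2 (by omega)).2
      (Or.inl ⟨rfl, (h.one_iff_of_gt h0 h3 (by omega)).2 ⟨rfl, rfl⟩⟩)⟩
  · intro a _ a' _ heq
    simpa using heq
  · rintro a ha b hb ⟨h2, h3, h4, h5, h6⟩
    obtain ⟨k, a, rfl, hk, hkn, ha'⟩ := exists_cons_of_mem_comps ha (by omega)
    obtain ⟨l, b, rfl, hl, hln, hb'⟩ := exists_cons_of_mem_comps hb (by omega)
    simp only [List.headI_cons, List.tail_cons] at h2 h3 h4 h5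
    subst h2
    obtain ⟨k, a, rfl, hk, hkn', ha''⟩ := exists_cons_of_mem_comps ha' (by omega)
    simp only [List.headI_cons] at h4 h5
    have h7 : (l - 2) :: 1 :: b ∈ comps (n - 1) :=
      cons_mem_comps.2 ⟨by omega, by omega,
        cons_mem_comps.2 ⟨by omega, by omega, by convert hb' using 2; omega⟩⟩
    rcases (h.two_iff_of_lt ha hb (by omega)).1 h6 with h8 | h8 | h8
    · have h9 := h8.2
      rw [consPos_of_pos (by omega), h.one_iff_of_gt ha' h7 (by omega),
        consPos_of_pos (by omega), List.cons.injEq] at h9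
      obtain ⟨h10, h11, rfl⟩ := h9
      obtain rfl : l = 3 := by omega
      obtain rfl : k = 3 := by omega
      exact ⟨a, by convert ha'' using 2; omega, rfl, rfl⟩
    · omega
    · omega

theorem cnt_two_two_three (h : IsDefect δ) {n : ℕ} (hn : 3 ≤ n) :
    cnt n (fun a b => a.headI = 2 ∧ b.headI = 3 ∧ δ a b = 2) = 2 ^ (n - 4) := by
  refine cnt_graph (n - 3) (fun l => 2 :: 1 :: l) (fun l => 3 :: l) ?_ ?_ ?_
  · intro a ha
    have h1 : 2 :: 1 :: a ∈ comps n :=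
      cons_mem_comps.2 ⟨by omega, by omega, cons_mem_comps.2 ⟨by omega, by omega, ha⟩⟩
    have h2 : 3 :: a ∈ comps n := cons_mem_comps.2 ⟨by omega, by omega, ha⟩
    exact ⟨h1, h2, rfl, rfl, (h.two_iff_of_lt h1 h2 (by omega)).2 (Or.inr (Or.inr ⟨rfl, rfl, rfl⟩))⟩
  · intro a _ a' _ heq
    exact (List.cons.inj heq).2
  · rintro a ha b hb ⟨h2, h3, h4⟩
    obtain ⟨k, a, rfl, hk, hkn, ha'⟩ := exists_cons_of_mem_comps ha (by omega)
    obtain ⟨l, b, rfl, hl, hln, hb'⟩ := exists_cons_of_mem_comps hb (by omega)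
    simp only [List.headI_cons] at h2 h3
    subst h2 h3
    rcases (h.two_iff_of_lt ha hb (by omega)).1 h4 with h5 | h5 | h5
    · omega
    · omega
    · exact ⟨b, hb', by rw [h5.2.2], rfl⟩

theorem cnt_two_two_four (h : IsDefect δ) {n : ℕ} (hn : 4 ≤ n) :
    cnt n (fun a b => a.headI = 2 ∧ 4 ≤ b.headI ∧ δ a b = 2) = 2 ^ (n - 4) := by
  refine cnt_graph (n - 3) (fun l => 2 :: consPos (l.headI - 1) (2 :: l.tail))
    (fun l => (l.headI + 3) :: l.tail) ?_ ?_ ?_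
  · intro a ha
    obtain ⟨k, a, rfl, hk, hkn, ha'⟩ := exists_cons_of_mem_comps ha (by omega)
    simp only [List.headI_cons, List.tail_cons]
    have h1 : 2 :: consPos (k - 1) (2 :: a) ∈ comps n :=
      cons_mem_comps.2 ⟨by omega, by omega, consPos_mem_comps.2 ⟨by omega,
        cons_mem_comps.2 ⟨by omega, by omega, by convert ha' using 2; omega⟩⟩⟩
    have h2 : (k + 3) :: a ∈ comps n :=
      cons_mem_comps.2 ⟨by omega, by omega, by convert ha' using 2; omega⟩
    refine ⟨h1, h2, trivial, by omega, (h.two_iff_of_lt h1 h2 (by omega)).2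
      (Or.inr (Or.inl ⟨rfl, by omega, ?_⟩))⟩
    rw [show k + 3 - 4 = k - 1 by omega]
  · intro a ha a' ha' heq
    obtain ⟨k, a, rfl, -⟩ := exists_cons_of_mem_comps ha (by omega)
    obtain ⟨k', a', rfl, -⟩ := exists_cons_of_mem_comps ha' (by omega)
    simpa using heq
  · rintro a ha b hb ⟨h2, h3, h4⟩
    obtain ⟨k, a, rfl, hk, hkn, ha'⟩ := exists_cons_of_mem_comps ha (by omega)
    obtain ⟨l, b, rfl, hl, hln, hb'⟩ := exists_cons_of_mem_comps hb (by omega)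
    simp only [List.headI_cons] at h2 h3
    subst h2
    rcases (h.two_iff_of_lt ha hb (by omega)).1 h4 with h5 | h5 | h5
    · omega
    · refine ⟨(l - 3) :: b, cons_mem_comps.2 ⟨by omega, by omega, by convert hb' using 2; omega⟩,
        ?_, ?_⟩
      · simp only [List.headI_cons, List.tail_cons]
        rw [h5.2.2, show l - 3 - 1 = l - 4 by omega]
      · simp only [List.headI_cons, List.tail_cons]
        rw [show l - 3 + 3 = l by omega]
    · omega

/-- By `two_iff_of_lt` the smaller first part is 1 or 2. For 1, the cases compare the second part of
`a` with `b.headI - 2`, which is the new first part on the right when positive; for 2, they separate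
the long reduction (`b` starting with 3) from the short one. -/
theorem cnt_lt_two (h : IsDefect δ) {n : ℕ} (hn : 4 ≤ n) :
    cnt n (fun a b => a.headI < b.headI ∧ δ a b = 2) =
      cnt (n - 1) (fun a b => b.headI = 1 ∧ δ a b = 1) +
      ∑ j ∈ Finset.range (n - 1), cnt j (fun a b => b.headI = 1 ∧ δ a b = 1) +
      4 * 2 ^ (n - 4) + 2 ^ (n - 5) := by
  have h1 : cnt n (fun a b => a.headI < b.headI ∧ δ a b = 2) = cnt n (fun a b =>
      (a.headI = 1 ∧ b.headI = 2 ∧ δ a b = 2) ∨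
      ((a.headI = 1 ∧ 3 ≤ b.headI ∧ a.tail.headI + 2 = b.headI ∧ δ a b = 2) ∨
      ((a.headI = 1 ∧ 3 ≤ b.headI ∧ a.tail.headI + 2 < b.headI ∧ δ a b = 2) ∨
      ((a.headI = 1 ∧ 3 ≤ b.headI ∧ b.headI < a.tail.headI + 2 ∧ a.tail.headI = 2 ∧ δ a b = 2) ∨
      ((a.headI = 1 ∧ 3 ≤ b.headI ∧ b.headI < a.tail.headI + 2 ∧ a.tail.headI ≠ 2 ∧ δ a b = 2) ∨
      ((a.headI = 2 ∧ b.headI = 3 ∧ δ a b = 2) ∨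
      (a.headI = 2 ∧ 4 ≤ b.headI ∧ δ a b = 2))))))) := by
    refine cnt_congr fun a ha b hb => ?_
    have h2 : a.headI < b.headI → δ a b = 2 → a.headI = 1 ∨ a.headI = 2 := by
      intro h3 h4
      obtain ⟨k, a, rfl, hk, hkn, ha'⟩ := exists_cons_of_mem_comps ha (by omega)
      obtain ⟨l, b, rfl, hl, hln, hb'⟩ := exists_cons_of_mem_comps hb (by omega)
      simp only [List.headI_cons] at h3 ⊢
      have := (h.two_iff_of_lt ha hb h3).1 h4
      omega
    omega
  rw [h1, cnt_or (by intro a b; omega), cnt_or (by intro a b; omega),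
    cnt_or (by intro a b; omega), cnt_or (by intro a b; omega), cnt_or (by intro a b; omega),
    cnt_or (by intro a b; omega), h.cnt_two_one_two (by omega), h.cnt_two_equal_second (by omega),
    h.cnt_two_second_lt hn, h.cnt_two_second_two (by omega), h.cnt_two_second_three hn,
    h.cnt_two_two_three (by omega), h.cnt_two_two_four hn]
  ring

theorem cnt_zero (h : IsDefect δ) (n : ℕ) : cnt n (fun a b => δ a b = 0) = 2 ^ (n - 1) := by
  rw [← cnt_eq]
  refine cnt_congr fun a ha b hb => ?_
  rw [mem_comps] at ha hb
  exact h.eq_zero_iff ha.1 hb.1 (ha.2.trans hb.2.symm)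

/-- Subtracting consecutive instances of `cnt_rec` removes the sum over smaller sizes. -/
theorem cnt_one_succ (h : IsDefect δ) {n : ℕ} (hn : 2 ≤ n) :
    cnt (n + 1) (fun a b => δ a b = 1) = 2 * cnt n (fun a b => δ a b = 1) + 2 ^ (n - 1) := by
  have h1 := h.cnt_rec 1 (n := n + 1) (by omega)
  have h2 := h.cnt_rec 1 (n := n) (by omega)
  rw [Finset.sum_range_succ, h.cnt_lt_one (by omega)] at h1
  rw [h.cnt_lt_one hn] at h2
  obtain ⟨m, rfl⟩ := Nat.exists_eq_add_of_le hn
  rw [show 2 + m + 1 - 2 = m + 1 by omega] at h1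
  rw [show 2 + m - 2 = m by omega] at h2
  rw [show 2 + m - 1 = m + 1 by omega]
  rw [pow_succ] at *
  omega

/-- Let `T d m` be the number of pairs of compositions of `m` with defect `d`. Subtracting `cnt_rec`
at `n + 4` from `cnt_rec` at `n + 5` cancels both layers of sums and leaves `T 2 (n+5) = 2 T 2 (n+4)
+ 2 T 1 (n+3) + 2^(n+3) + 9 · 2^n`. Two applications of `cnt_one_succ` replace `T 1 (n+3)` by `4 T 1
(n+1) + 4 · 2^n`. The powers of two add up to `25 · 2^n = 50 · 2^(n-1)`, that is, to `50 T 0 n`. -/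
theorem cnt_recursion (h : IsDefect δ) {n : ℕ} (hn : 1 ≤ n) :
    50 * cnt n (fun a b => δ a b = 0) + 8 * cnt (n + 1) (fun a b => δ a b = 1) +
      2 * cnt (n + 4) (fun a b => δ a b = 2) = cnt (n + 5) (fun a b => δ a b = 2) := by
  have h1 := h.cnt_rec 2 (n := n + 5) (by omega)
  have h2 := h.cnt_rec 2 (n := n + 4) (by omega)
  rw [Finset.sum_range_succ, h.cnt_lt_two (by omega), show n + 5 - 1 = n + 3 + 1 by omega,
    Finset.sum_range_succ fun j => cnt j fun a b => b.headI = 1 ∧ δ a b = 1, h.cnt_head_one (n := n + 3 + 1) (by omega)] at h1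
  rw [h.cnt_lt_two (by omega), show n + 4 - 1 = n + 3 by omega] at h2
  have h3 := h.cnt_one_succ (n := n + 1) (by omega)
  have h4 := h.cnt_one_succ (n := n + 2) (by omega)
  rw [h.cnt_zero]
  obtain ⟨m, rfl⟩ := Nat.exists_eq_add_of_le' hn
  simp only [Nat.reduceAdd, Nat.add_assoc, Nat.reduceSubDiff, Nat.add_sub_cancel] at *
  simp only [pow_succ] at *
  omega

end IsDefect

/-! ### The defect of seaweed algebras satisfies the recursion. -/

/-- Keeps the truncated subtraction in `defect` honest. Zero parts can occur, for instance from `e =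
0`; dropping one leaves `n` unchanged, which is why the lengths enter the induction measure. -/
theorem listIndex_le (K : Type*) [Field K] [CharZero K] (a b : List ℕ) (n : ℕ) (ha : a.sum = n)
    (hb : b.sum = n) : listIndex K a b n ≤ n := by
  induction h : n + a.length + b.length using Nat.strong_induction_on generalizing a b n with
  | _ N ih =>
    subst h
    have key (k l : ℕ) (a' b' : List ℕ) (ha : k + a'.sum = n) (hb : l + b'.sum = n)
        (hlen : a'.length + b'.length + 2 = a.length + b.length) (hkl : k < l) :
        listIndex K (k :: a') (l :: b') n ≤ n := by
      rcases Nat.eq_zero_or_pos k with rfl | hk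
      · rw [listIndex_zero_cons_left]
        exact ih _ (by simp; omega) a' (l :: b') n (by omega) (by simpa using hb) rfl
      · by_cases h2 : 2 * k ≤ l
        · obtain ⟨e, rfl⟩ := Nat.exists_eq_add_of_le h2
          obtain rfl : n = a'.sum + k := by omega
          rw [show 2 * k + e = k + e + k by omega, listIndex_short K a' b' k e a'.sum (by omega)]
          have := ih _ (by simp; omega) a' (e :: k :: b') a'.sum rfl (by simp; omega) rfl
          omega
        · obtain ⟨m, rfl⟩ := Nat.exists_eq_add_of_lt hkl
          obtain ⟨e, rfl⟩ := Nat.exists_eq_add_of_le (show m + 1 ≤ k by omega)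
          obtain ⟨p, rfl⟩ := Nat.exists_eq_add_of_le' (show m + 1 ≤ n by omega)
          rw [show m + 1 + e + m + 1 = e + (m + 1) + (m + 1) by omega,
            show m + 1 + e = e + (m + 1) by omega,
            listIndex_long K a' b' e (m + 1) p (by omega)]
          have := ih _ (by simp; omega) (e :: a') ((e + (m + 1)) :: b') p (by simp; omega)
            (by simp; omega) rfl
          omega
    cases a with
    | nil =>
      obtain rfl : n = 0 := by simpa using ha.symm
      rw [listIndex_nil]
    | cons k a =>
      cases b with
      | nil =>
        obtain rfl : n = 0 := by simpa using hb.symm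
        rw [listIndex_nil]
      | cons l b =>
        rcases lt_trichotomy k l with hkl | rfl | hkl
        · exact key k l a b (by simpa using ha) (by simpa using hb) (by simp; omega) hkl
        · simp only [List.sum_cons, List.length_cons] at ha hb ih
          subst ha
          rw [listIndex_cons_cons]
          have := ih _ (by omega) a b a.sum rfl (by omega) rfl
          omega
        · rw [listIndex_comm]
          exact key l k b a (by simpa using hb) (by simpa using ha) (by simp; omega) hkl

/-- The difference between `n` and the index of the seaweed algebra of type `a | b` in `gl n`. -/
noncomputable def defect (K : Type*) [Field K] (a b : List ℕ) : ℕ :=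
  a.sum - listIndex K a b a.sum

theorem listIndex_consPos_left (K : Type*) [Field K] (k : ℕ) (a b : List ℕ) (n : ℕ) :
    listIndex K (consPos k a) b n = listIndex K (k :: a) b n := by
  rcases Nat.eq_zero_or_pos k with rfl | hk
  · rw [listIndex_zero_cons_left, consPos_zero]
  · rw [consPos_of_pos hk]

theorem listIndex_consPos_right (K : Type*) [Field K] (k : ℕ) (a b : List ℕ) (n : ℕ) :
    listIndex K a (consPos k b) n = listIndex K a (k :: b) n := by
  rw [listIndex_comm, listIndex_consPos_left, listIndex_comm]

theorem isDefect_defect (K : Type*) [Field K] [CharZero K] : IsDefect (defect K) where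
  nil := by simp [defect]
  comm a b h := by rw [defect, defect, h, listIndex_comm]
  cons_cons k a b h := by
    rw [defect, defect, List.sum_cons, listIndex_cons_cons]
    omega
  short k e a b h := by
    have := listIndex_le K a (e :: k :: b) a.sum rfl (by simp; omega)
    rw [defect, defect, List.sum_cons, listIndex_consPos_right, Nat.add_comm k,
      listIndex_short K a b k e a.sum (by omega)]
    omega
  long e m a b h := by
    have := listIndex_le K (e :: a) ((e + m) :: b) (e + a.sum) rfl (by simp; omega)
    rw [defect, defect, List.sum_cons, consPos_sum, listIndex_consPos_left, Nat.add_right_comm,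
      listIndex_long K a b e m (e + a.sum) (by omega)]
    omega

/-- The 1 in `k + 1 + d = n` is the scalar direction lost in passing from `gl n` to `sl n`. -/
theorem seaweedCount_eq_cnt (K : Type*) [Field K] [CharZero K] {n k d : ℕ} (h : k + 1 + d = n) :
    seaweedCount K n k = cnt n fun a b => defect K a b = d := by
  classical
  have hiff (a b : Composition n) :
      lieIndex K (seaweed K a b) = k ↔ defect K a.blocks b.blocks = d := by
    have h1 := lieIndex_seaweed_add_one (K := K) (show n ≠ 0 by omega) a b
    have h2 := listIndex_le K a.blocks b.blocks n a.blocks_sum b.blocks_sum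
    rw [defect, a.blocks_sum]
    omega
  rw [seaweedCount, Nat.card_eq_fintype_card, Fintype.card_subtype, cnt]
  refine Finset.card_bij (fun p _ => (p.1.blocks, p.2.blocks)) ?_ ?_ ?_
  · intro p hp
    simp only [Finset.mem_filter, Finset.mem_univ, true_and] at hp
    simp [comps, (hiff _ _).1 hp]
  · intro p _ q _ hpq
    rw [Prod.mk.injEq] at hpq
    exact Prod.ext (Composition.blocks_injective n hpq.1) (Composition.blocks_injective n hpq.2)
  · rintro ⟨a, b⟩ hp
    simp only [Finset.mem_filter, Finset.mem_product, comps, Finset.mem_image, Finset.mem_univ,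
      true_and] at hp
    obtain ⟨⟨⟨a, rfl⟩, b, rfl⟩, hp⟩ := hp
    exact ⟨(a, b), by simpa using (hiff a b).2 hp, rfl⟩

theorem mainTheorem3 (K : Type*) [Field K] [IsAlgClosed K] [CharZero K] (n : ℕ) (hn : 1 ≤ n) :
    50 * seaweedCount K n (n - 1) + 8 * seaweedCount K (n + 1) (n - 1)
        + 2 * seaweedCount K (n + 4) (n + 1)
      = seaweedCount K (n + 5) (n + 2) := by
  rw [seaweedCount_eq_cnt K (d := 0) (by omega), seaweedCount_eq_cnt K (d := 1) (by omega),
    seaweedCount_eq_cnt K (d := 2) (by omega), seaweedCount_eq_cnt K (d := 2) (by omega)]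
  exact (isDefect_defect K).cnt_recursion hn
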